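/- Let $K$ be a field. A Brauer configuration $\Gamma=(\Gamma_0,\Gamma_1,\mu,\mathfrak o)$ consists of a finite set $\Gamma_0$ of vertices, a finite collection $\Gamma_1$ of labeled finite multisets of vertices (the polygons), a multiplicity function $\mu:\Gamma_0\to\mathbb Z_{>0}$ and an orientation $\mathfrak o$. Write $\mathrm{occ}(\alpha,V)$ for the number of times $\alpha$ occurs in the polygon $V$ and $\mathrm{val}(\alpha)=\sum_{V\in\Gamma_1}\mathrm{occ}(\alpha,V)$. The orientation is a choice, for each vertex $\alpha$, of a cyclic ordering $V_1<\dots<V_t<V_1$, $t=\mathrm{val}(\alpha)$, of the list in which each polygon $V$ appears $\mathrm{occ}(\alpha,V)$ times. It is required that every vertex lies in some polygon, that every polygon has at least two vertices (counted with repetition), and that every polygon contains a vertex $\alpha$ with $\mathrm{val}(\alpha)\mu(\alpha)>1$. A vertex is truncated if $\mathrm{val}(\alpha)\mu(\alpha)=1$. $\Gamma$ is reduced if every polygon that contains a truncated vertex is a $2$-gon with exactly one truncated vertex. $\Gamma$ is connected if $\Gamma_1\neq\emptyset$ and $\Gamma_1$ is not the disjoint union of two nonempty subcollections such that no vertex lies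 both in a polygon of the first and in a polygon of the second. The quiver $Q$ of $\Gamma$ has one vertex $v$ for each polygon $V$ and, for each nontruncated vertex $\alpha$ and each $1\le i\le t=\mathrm{val}(\alpha)$, an arrow $a_i^{(\alpha)}:v_i\to v_{i+1}$, where $V_1<\dots<V_t$ is the cyclic ordering at $\alpha$ and indices are read modulo $t$. The special $\alpha$-cycles are the $t$ cycles $C=a^{(\alpha)}_i a^{(\alpha)}_{i+1}\cdots a^{(\alpha)}_{i+t-1}$; such a $C$ is a special $\alpha$-cycle at $v_i$, and its first arrow is $f(C)=a^{(\alpha)}_i$. (Paths are written from left to right.) Let $I$ be the two-sided ideal of the path algebra $KQ$ generated by 1. all $C^{\mu(\alpha)}-D^{\mu(\beta)}$, where $C$ is a special $\alpha$-cycle and $D$ a special $\beta$-cycle at the same vertex of $Q$; 2. all $C^{\mu(\alpha)}f(C)$, where $C$ is a special $\alpha$-cycle; 3. all paths $ab$ of length two that are not a subpath of any special cycle, except for the paths $aa$ where $a$ is the loop of a vertex $\alpha$ with $\mathrm{val}(\alpha)=1$ and $\mu(\alpha)>1$. The Brauer configuration algebra of $\Gamma$ is $\Lambda=KQ/I$;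 write $\overline x$ for the class of $x$. **Theorem.** Let $\Gamma$ be a connected and reduced Brauer configuration and $\Lambda=KQ/I$ its Brauer configuration algebra. Then the center $Z(\Lambda)$ is finite dimensional and $$\dim_K Z(\Lambda)=1+\sum_{\alpha\in\Gamma_0}\mu(\alpha)+|\Gamma_1|-|\Gamma_0|+\#\mathrm{Loops}(Q)-|\mathscr C_\Gamma|,$$ where $\#\mathrm{Loops}(Q)$ is the number of loops of $Q$ and $\mathscr C_\Gamma=\{\alpha\in\Gamma_0 : \mathrm{val}(\alpha)=1,\ \mu(\alpha)>1\}$. Moreover, the following elements, indexed as indicated, form a $K$-basis of $Z(\Lambda)$: * the unit $1$; * $C(\alpha)^j$ for $\alpha$ nontruncated and $1\le j\le\mu(\alpha)-1$, where $C(\alpha)$ is the sum of the classes $\overline C$ of all special $\alpha$-cycles $C$; * $C^{(V)}$ for $V\in\Gamma_1$, where $C^{(V)}=\overline C^{\,\mu(\alpha)}$ for any nontruncated $\alpha\in V$ and any special $\alpha$-cycle $C$ at $v$ (this is independent of the choices); * for each loop $a=a^{(\alpha)}_i$ of $Q$ with $\mathrm{val}(\alpha)>1$, the class of $C^{\mu(\alpha)-1}q$,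 where $C=a^{(\alpha)}_{i+1}\cdots a^{(\alpha)}_{i-1}a^{(\alpha)}_{i}$ is the special $\alpha$-cycle whose last arrow is $a$ and $q=a^{(\alpha)}_{i+1}\cdots a^{(\alpha)}_{i-1}$ is the path obtained from $C$ by deleting this last arrow (the central mixed cycle $D^{(\alpha)}_{V,s}$ of $a$). -/

import Mathlib

/-! ### The path algebra of a quiver -/

section PathAlgebra

variable (K : Type*) (Q : Type*) [Field K] [Quiver Q]

/-- All paths of the quiver `Q`, of any length and between any two vertices. -/
abbrev QuiverPath : Type _ := Σ v w : Q, Quiver.Path v w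

/-- The path algebra `KQ`: formal `K`-linear combinations of the paths of `Q`. -/
def PathAlgebra : Type _ := QuiverPath Q →₀ K

namespace PathAlgebra

noncomputable instance : AddCommGroup (PathAlgebra K Q) :=
  inferInstanceAs (AddCommGroup (QuiverPath Q →₀ K))

noncomputable instance : Module K (PathAlgebra K Q) :=
  inferInstanceAs (Module K (QuiverPath Q →₀ K))

variable {Q}

/-- The basis element of `KQ` given by a path. -/
noncomputable def ofPath {v w : Q} (p : Quiver.Path v w) : PathAlgebra K Q :=
  Finsupp.single (⟨v, w, p⟩ : QuiverPath Q) (1 : K)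

open Classical in
/-- The product of two paths: their concatenation (first `p`, then `q`) if `p` ends where `q`
starts, and zero otherwise. -/
noncomputable def pathMul (p q : QuiverPath Q) : PathAlgebra K Q :=
  if h : p.2.1 = q.1 then ofPath K (p.2.2.comp (q.2.2.cast h.symm rfl)) else 0

variable (Q) in
/-- The multiplication of `KQ`: the bilinear extension of the product of paths. -/
noncomputable def mulHom : PathAlgebra K Q →ₗ[K] PathAlgebra K Q →ₗ[K] PathAlgebra K Q :=
  Finsupp.linearCombination K (fun p : QuiverPath Q =>
    (Finsupp.linearCombination K (fun q : QuiverPath Q => pathMul K p q) :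
      PathAlgebra K Q →ₗ[K] PathAlgebra K Q))

noncomputable instance : Mul (PathAlgebra K Q) := ⟨fun x y => mulHom K Q x y⟩

/-- The identity of `KQ`: the sum of the paths of length zero. -/
noncomputable instance [Fintype Q] : One (PathAlgebra K Q) :=
  ⟨∑ v : Q, ofPath K (Quiver.Path.nil : Quiver.Path v v)⟩

theorem mul_def (x y : PathAlgebra K Q) : x * y = mulHom K Q x y := rfl

theorem one_def [Fintype Q] :
    (1 : PathAlgebra K Q) = ∑ v : Q, ofPath K (Quiver.Path.nil : Quiver.Path v v) := rfl

theorem induction_paths {P : PathAlgebra K Q → Prop} (x : PathAlgebra K Q) (h0 : P 0)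
    (hadd : ∀ x y, P x → P y → P (x + y))
    (hpath : ∀ (c : K) (v w : Q) (p : Quiver.Path v w), P (c • ofPath K p)) : P x := by
  refine Finsupp.induction_linear (motive := P) x h0 (fun f g hf hg => hadd f g hf hg) ?_
  rintro ⟨v, w, p⟩ c
  have h := hpath c v w p
  have e : c • ofPath K p = (Finsupp.single (⟨v, w, p⟩ : QuiverPath Q) c : QuiverPath Q →₀ K) := by
    unfold ofPath
    exact (Finsupp.smul_single _ _ _).trans (by simp)
  rwa [e] at h

theorem mulHom_ofPath {u v w x : Q} (p : Quiver.Path u v) (q : Quiver.Path w x) :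
    mulHom K Q (ofPath K p) (ofPath K q) = pathMul K ⟨u, v, p⟩ ⟨w, x, q⟩ := by
  unfold mulHom ofPath
  erw [Finsupp.linearCombination_single, one_smul, Finsupp.linearCombination_single, one_smul]

theorem ofPath_mul_ofPath {u v w : Q} (p : Quiver.Path u v) (q : Quiver.Path v w) :
    ofPath K p * ofPath K q = ofPath K (p.comp q) := by
  rw [mul_def, mulHom_ofPath]
  simp [pathMul]

theorem ofPath_mul_ofPath_of_ne {u v w x : Q} (h : v ≠ w) (p : Quiver.Path u v)
    (q : Quiver.Path w x) : ofPath K p * ofPath K q = 0 := by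
  rw [mul_def, mulHom_ofPath]
  simp [pathMul, h]

theorem ofPath_mul_assoc {a b c d e f : Q} (p : Quiver.Path a b) (q : Quiver.Path c d)
    (r : Quiver.Path e f) :
    ofPath K p * ofPath K q * ofPath K r = ofPath K p * (ofPath K q * ofPath K r) := by
  have hz : ∀ x : PathAlgebra K Q, x * 0 = 0 := fun x => (mulHom K Q x).map_zero
  have hz' : ∀ x : PathAlgebra K Q, 0 * x = 0 := fun x => by
    rw [mul_def, map_zero, LinearMap.zero_apply]
  by_cases h : b = c
  · subst h
    rw [ofPath_mul_ofPath]
    by_cases h' : d = e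
    · subst h'
      simp only [ofPath_mul_ofPath, Quiver.Path.comp_assoc]
    · rw [ofPath_mul_ofPath_of_ne K h', ofPath_mul_ofPath_of_ne K h', hz]
  · rw [ofPath_mul_ofPath_of_ne K h, hz']
    by_cases h' : d = e
    · subst h'
      rw [ofPath_mul_ofPath, ofPath_mul_ofPath_of_ne K h]
    · rw [ofPath_mul_ofPath_of_ne K h', hz]

noncomputable instance instRing [Fintype Q] : Ring (PathAlgebra K Q) :=
  { (inferInstance : AddCommGroup (PathAlgebra K Q)),
    (inferInstance : Mul (PathAlgebra K Q)),
    (inferInstance : One (PathAlgebra K Q)) with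
    left_distrib := fun x y z => (mulHom K Q x).map_add y z
    right_distrib := fun x y z => by
      simp only [mul_def, map_add, LinearMap.add_apply]
    zero_mul := fun x => by simp only [mul_def, map_zero, LinearMap.zero_apply]
    mul_zero := fun x => (mulHom K Q x).map_zero
    mul_assoc := fun x y z => by
      induction x using induction_paths with
      | h0 => simp only [mul_def, map_zero, LinearMap.zero_apply]
      | hadd x x' hx hx' =>
        simp only [mul_def, map_add, LinearMap.add_apply] at hx hx' ⊢
        rw [hx, hx']
      | hpath a _ _ p =>
        induction y using induction_paths with
        | h0 => simp only [mul_def, map_zero, LinearMap.zero_apply]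
        | hadd y y' hy hy' =>
          simp only [mul_def, map_add, LinearMap.add_apply] at hy hy' ⊢
          rw [hy, hy']
        | hpath b _ _ q =>
          induction z using induction_paths with
          | h0 => simp only [mul_def, map_zero]
          | hadd z z' hz hz' =>
            simp only [mul_def, map_add] at hz hz' ⊢
            rw [hz, hz']
          | hpath c _ _ r =>
            have h := ofPath_mul_assoc K p q r
            simp only [mul_def, map_smul, LinearMap.smul_apply] at h ⊢
            rw [h]
    one_mul := fun x => by
      classical
      induction x using induction_paths with
      | h0 => exact (mulHom K Q _).map_zero
      | hadd x x' hx hx' =>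
        rw [mul_def] at hx hx' ⊢
        rw [map_add, hx, hx']
      | hpath a v w p =>
        rw [mul_def, map_smul, one_def, map_sum, LinearMap.sum_apply,
          Finset.sum_eq_single v]
        · rw [← mul_def, ofPath_mul_ofPath, Quiver.Path.nil_comp]
        · intro b _ hb
          rw [← mul_def, ofPath_mul_ofPath_of_ne K hb]
        · simp
    mul_one := fun x => by
      classical
      induction x using induction_paths with
      | h0 => simp only [mul_def, map_zero, LinearMap.zero_apply]
      | hadd x x' hx hx' =>
        rw [mul_def] at hx hx' ⊢
        rw [map_add, LinearMap.add_apply, hx, hx']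
      | hpath a v w p =>
        rw [mul_def, map_smul, LinearMap.smul_apply, one_def, map_sum,
          Finset.sum_eq_single w]
        · rw [← mul_def, ofPath_mul_ofPath, Quiver.Path.comp_nil]
        · intro b _ hb
          rw [← mul_def, ofPath_mul_ofPath_of_ne K hb.symm]
        · simp }

noncomputable instance instAlgebra [Fintype Q] : Algebra K (PathAlgebra K Q) :=
  Algebra.ofModule
    (fun r x y => by simp only [mul_def, map_smul, LinearMap.smul_apply])
    (fun r x y => by simp only [mul_def, map_smul])

end PathAlgebra

end PathAlgebra

/-! ### Brauer configurations -/

/-- A Brauer configuration with vertex set `V` (that is, `Γ₀`) and set of (labels of) polygons `P`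
(that is, `Γ₁`). Each polygon is a finite multiset of vertices. The orientation is given by
the successor sequence `seq α` at each vertex `α`: a linear representative
`V₁ < ⋯ < V_t` of the cyclic order of the polygons in which `α` occurs, each polygon being listed
as often as `α` occurs in it; it is read cyclically. -/
structure BrauerConfiguration (V P : Type*) [Fintype P] [DecidableEq V] [DecidableEq P] where
  /-- the multiset of the vertices of a polygon -/
  polygon : P → Multiset V
  /-- the multiplicity function -/
  mult : V → ℕ
  mult_pos : ∀ α, 0 < mult α
  /-- the orientation -/
  seq : V → List P
  count_seq : ∀ α p, (seq α).count p = (polygon p).count α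
  /-- Every vertex is a vertex of at least one polygon. -/
  exists_polygon : ∀ α, ∃ p, α ∈ polygon p
  /-- Every polygon has at least two vertices, counted with repetitions. -/
  two_le_card : ∀ p, 2 ≤ (polygon p).card
  /-- Every polygon has a vertex `α` with `val(α) μ(α) > 1`. -/
  exists_nontruncated : ∀ p, ∃ α ∈ polygon p, 1 < (∑ q : P, (polygon q).count α) * mult α

namespace BrauerConfiguration

variable {V P : Type*} [Fintype P] [DecidableEq V] [DecidableEq P]
variable (Γ : BrauerConfiguration V P)

/-- `occ(α, p)`: the number of times `α` occurs as a vertex of the polygon `p`. -/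
def occ (α : V) (p : P) : ℕ := (Γ.polygon p).count α

/-- The valency of a vertex. -/
def val (α : V) : ℕ := ∑ p : P, Γ.occ α p

/-- Truncated vertices: `val(α) μ(α) = 1`. -/
def Truncated (α : V) : Prop := Γ.val α * Γ.mult α = 1

instance : DecidablePred Γ.Truncated := fun α =>
  inferInstanceAs (Decidable (Γ.val α * Γ.mult α = 1))

/-- `Γ` is reduced: a polygon that has truncated vertices is a 2-gon with exactly one truncated
vertex. -/
def Reduced : Prop :=
  ∀ p : P, (∀ α ∈ Γ.polygon p, ¬ Γ.Truncated α) ∨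
    ((Γ.polygon p).card = 2 ∧ (Γ.polygon p).countP Γ.Truncated = 1)

/-- `Γ` is connected: it has a polygon, and the polygons cannot be split into two nonempty classes
such that no polygon of the first class has a vertex in common with one of the second class. -/
def Connected : Prop :=
  Nonempty P ∧ ∀ S : Set P, S.Nonempty → Sᶜ.Nonempty →
    ∃ p ∈ S, ∃ q ∈ Sᶜ, ∃ α, α ∈ Γ.polygon p ∧ α ∈ Γ.polygon q

/-- The set `𝒞_Γ` of the vertices of valency one and multiplicity greater than one. -/
def setC [Fintype V] : Finset V := Finset.univ.filter fun α => Γ.val α = 1 ∧ 1 < Γ.mult α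

/-! ### The quiver of a Brauer configuration -/

/-- The arrows of the quiver: one for each nontruncated vertex `α` and each position in the
successor sequence at `α`. -/
def Arrow : Type _ := Σ α : {α : V // ¬ Γ.Truncated α}, Fin (Γ.seq α).length

variable {Γ}

/-- The nontruncated vertex of `Γ` that an arrow belongs to. -/
def Arrow.vertex (a : Γ.Arrow) : V := a.1

/-- The arrow at the same vertex and at the cyclically next position. -/
def Arrow.next (a : Γ.Arrow) : Γ.Arrow := ⟨a.1, finRotate _ a.2⟩

/-- An arrow starts at the polygon at its position ... -/
def Arrow.src (a : Γ.Arrow) : P := (Γ.seq a.1).get a.2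

/-- ... and ends at the successor of that polygon. -/
def Arrow.tgt (a : Γ.Arrow) : P := a.next.src

variable (Γ)

/-- The vertices of the quiver of `Γ` are the polygons of `Γ`. -/
@[nolint unusedArguments]
def QuiverVertex (_Γ : BrauerConfiguration V P) : Type _ := P

instance : Fintype Γ.QuiverVertex := inferInstanceAs (Fintype P)

/-- The quiver of `Γ`. -/
instance : Quiver Γ.QuiverVertex where
  Hom v w := {a : Γ.Arrow // a.src = v ∧ a.tgt = w}

/-- The number of loops of the quiver of `Γ`. -/
noncomputable def numLoops : ℕ := Nat.card (Σ v : Γ.QuiverVertex, (v ⟶ v))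

variable {Γ}

/-- The start of an arrow as a vertex of the quiver. -/
def Arrow.start (a : Γ.Arrow) : Γ.QuiverVertex := a.src

/-- An arrow as a morphism of the quiver. -/
def Arrow.hom (a : Γ.Arrow) : a.start ⟶ a.next.start := ⟨a, rfl, rfl⟩

/-- The arrow `n` positions after `a`. -/
def Arrow.shift (a : Γ.Arrow) : ℕ → Γ.Arrow
  | 0 => a
  | n + 1 => (a.shift n).next

/-- The path of length `n` that starts with `a` and goes on with the arrows that follow `a`
cyclically in the successor sequence. -/
def Arrow.walk (a : Γ.Arrow) : (n : ℕ) → Quiver.Path a.start (a.shift n).start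
  | 0 => Quiver.Path.nil
  | n + 1 => (a.walk n).cons (a.shift n).hom

/-- The special cycle with first arrow `a`: it runs once around the successor sequence. -/
def Arrow.specialCycle (a : Γ.Arrow) :
    Quiver.Path a.start (a.shift (Γ.val a.vertex)).start :=
  a.walk (Γ.val a.vertex)

/-- The path `ab` is a subpath of the path `c`. -/
def IsSubpathTwo {s t u v w : Γ.QuiverVertex} (a : u ⟶ v) (b : v ⟶ w) (c : Quiver.Path s t) :
    Prop :=
  ∃ (p : Quiver.Path s u) (q : Quiver.Path w t), c = p.comp ((a.toPath.comp b.toPath).comp q)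

variable (Γ)

/-! ### The Brauer configuration algebra -/

section Algebra

variable (K : Type*) [Field K]

variable {Γ} in
/-- The special cycle with first arrow `a`, in the path algebra. -/
noncomputable def Arrow.cycleElt (a : Γ.Arrow) : PathAlgebra K Γ.QuiverVertex :=
  PathAlgebra.ofPath K a.specialCycle

/-- Relations of type one: `C^μ(α) - D^μ(β)` for special cycles `C` (an `α`-cycle) and `D`
(a `β`-cycle) at the same vertex of the quiver. -/
def relOne : Set (PathAlgebra K Γ.QuiverVertex) :=
  {x | ∃ a b : Γ.Arrow, a.src = b.src ∧
    x = a.cycleElt K ^ Γ.mult a.vertex - b.cycleElt K ^ Γ.mult b.vertex}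

/-- Relations of type two: `C^μ(α) f(C)`, where `f(C)` is the first arrow of the special
`α`-cycle `C`. -/
def relTwo : Set (PathAlgebra K Γ.QuiverVertex) :=
  {x | ∃ a : Γ.Arrow,
    x = a.cycleElt K ^ Γ.mult a.vertex * PathAlgebra.ofPath K a.hom.toPath}

/-- Relations of type three: the paths `ab` of length two that are not a subpath of any special
cycle, except for the squares `aa` of the loops `a` that belong to a nontruncated vertex of
valency one. -/
def relThree : Set (PathAlgebra K Γ.QuiverVertex) :=
  {x | ∃ (u v w : Γ.QuiverVertex) (a : u ⟶ v) (b : v ⟶ w),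
    (∀ c : Γ.Arrow, ¬ IsSubpathTwo a b c.specialCycle) ∧
    ¬ (a.1 = b.1 ∧ Γ.val a.1.vertex = 1) ∧
    x = PathAlgebra.ofPath K (a.toPath.comp b.toPath)}

/-- The ideal `I` generated by all relations. -/
noncomputable def relIdeal : TwoSidedIdeal (PathAlgebra K Γ.QuiverVertex) :=
  TwoSidedIdeal.span (Γ.relOne K ∪ Γ.relTwo K ∪ Γ.relThree K)

/-- The Brauer configuration algebra `Λ = KQ/I`. -/
abbrev Alg : Type _ := (Γ.relIdeal K).ringCon.Quotient

/-- The canonical surjection `KQ → Λ`. -/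
noncomputable def proj : PathAlgebra K Γ.QuiverVertex →+* Γ.Alg K := (Γ.relIdeal K).ringCon.mk'

/-- The element `C(α)` of `Λ`, the sum of the classes of the special `α`-cycles. -/
noncomputable def sumCycles (α : {α : V // ¬ Γ.Truncated α}) : Γ.Alg K :=
  ∑ i : Fin (Γ.seq α).length, Γ.proj K (Arrow.cycleElt K (⟨α, i⟩ : Γ.Arrow))

variable {Γ} in
/-- For a loop `a` at a vertex `α` with `val(α) > 1`, the central mixed `α`-cycle attached to `a`:
if `C` is the special `α`-cycle that starts with the arrow following `a`, it is `C^(μ(α)-1) q`,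
where `q` is `C` without its last arrow `a`. -/
noncomputable def Arrow.mixedCycle (a : Γ.Arrow) : PathAlgebra K Γ.QuiverVertex :=
  a.next.cycleElt K ^ (Γ.mult a.vertex - 1) *
    PathAlgebra.ofPath K (a.next.walk (Γ.val a.vertex - 1))

end Algebra

/-- Labels of the elements of the basis of the center. -/
inductive CenterIndex : Type _
  /-- for the identity of `Λ` -/
  | one : CenterIndex
  /-- for `C(α)^j`, `1 ≤ j ≤ μ(α) - 1` -/
  | power (α : {α : V // ¬ Γ.Truncated α}) (j : ℕ) (hj : 1 ≤ j ∧ j ≤ Γ.mult α - 1) : CenterIndex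
  /-- for `C^(p)`, `p` a polygon -/
  | socle (p : P) : CenterIndex
  /-- for the mixed cycle of a loop at a vertex of valency greater than one -/
  | mixed (a : Γ.Arrow) (ha : a.src = a.tgt) (hval : 1 < Γ.val a.vertex) : CenterIndex

end BrauerConfiguration

namespace BrauerConfiguration

variable {V P : Type*} [Fintype P] [DecidableEq V] [DecidableEq P]
variable {Γ : BrauerConfiguration V P}

/-! ### Combinatorics of the arrows -/

/-! Every arrow has a unique successor in the orientation, and modulo `I` a path is zero unless each
arrow is followed by its successor. So Λ is spanned by walks `a.walkClass n`, with `n` at most L =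
val(α)μ(α). Walks of length 0 depend only on the start polygon, and so do walks of length L. This
leaves one idempotent per polygon, the walks with 0 < n < L, and one socle element per polygon
(`mem_span_range_toAlg`). Independence comes from explicit functionals on KQ. Each sums the
coefficients of all paths representing a given word; it kills every product `y * x * z` with `x` a
relation, so it descends to Λ (`Word.coeff_eq_zero_of_mem`, `Word.coord_toAlg`). For central z,
compare coefficients in az = za. The idempotent coordinates agree along every arrow, hence
everywhere by connectedness (`Word.coord_idem_eq`). If n + 1 < L, the coordinate at a walk of length
n vanishes unless val(α) divides n, and is then constant around α (`Word.coord_walk_next`). Length L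
- 1 escapes this comparison: there z = ze + ... only forces the walk to be closed, that is, the one
missing arrow to be a loop. If val(α) = 1 that walk is already a power of C(α); otherwise it is a
mixed cycle. Thus finitely many coordinates determine a central element (`eq_zero_of_mem_center`),
and the listed central elements are dual to them (`CenterIndex.coord_word_toAlg`), so they form a
basis. Counting loops by valency gives the dimension. -/

theorem length_seq (α : V) : (Γ.seq α).length = Γ.val α := by
  have h := (Multiset.sum_count_eq_card (s := (Finset.univ : Finset P)) (m := (Γ.seq α : Multiset P))
    (by simp))
  simp only [Multiset.coe_count, Multiset.coe_card] at h
  rw [← h]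
  exact Finset.sum_congr rfl fun p _ => Γ.count_seq α p

theorem val_pos (α : V) : 0 < Γ.val α := by
  obtain ⟨p, hp⟩ := Γ.exists_polygon α
  exact Finset.sum_pos' (fun _ _ => Nat.zero_le _)
    ⟨p, Finset.mem_univ p, Multiset.count_pos.2 hp⟩

/-- The length `val(α) μ(α)` of the power of a special cycle that lies in the socle. -/
def Arrow.socleLength (a : Γ.Arrow) : ℕ := Γ.val a.vertex * Γ.mult a.vertex

theorem Arrow.two_le_socleLength (a : Γ.Arrow) : 2 ≤ a.socleLength := by
  have h1 : 0 < a.socleLength := Nat.mul_pos (val_pos _) (Γ.mult_pos _)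
  have h2 : a.socleLength ≠ 1 := a.1.2
  omega

theorem Arrow.ext_pos {a b : Γ.Arrow} (h : a.1 = b.1) (h' : (a.2 : ℕ) = b.2) : a = b := by
  obtain ⟨α, i⟩ := a
  obtain ⟨β, j⟩ := b
  obtain rfl : α = β := h
  obtain rfl : i = j := Fin.ext h'
  rfl

theorem coe_finRotate_eq_mod {n : ℕ} (i : Fin n) : (finRotate n i : ℕ) = (i + 1) % n := by
  cases n with
  | zero => exact i.elim0
  | succ n => rw [finRotate_apply, Fin.val_add, Fin.val_one', Nat.add_mod_mod]

theorem Arrow.next_pos (a : Γ.Arrow) : (a.next.2 : ℕ) = (a.2 + 1) % Γ.val a.vertex := by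
  rw [← length_seq]
  exact coe_finRotate_eq_mod a.2

theorem Arrow.shift_fst (a : Γ.Arrow) (n : ℕ) : (a.shift n).1 = a.1 := by
  induction n with
  | zero => rfl
  | succ n ih => exact ih

theorem Arrow.vertex_shift (a : Γ.Arrow) (n : ℕ) : (a.shift n).vertex = a.vertex :=
  congrArg Subtype.val (a.shift_fst n)

theorem Arrow.vertex_next (a : Γ.Arrow) : a.next.vertex = a.vertex := rfl

theorem Arrow.socleLength_shift (a : Γ.Arrow) (n : ℕ) :
    (a.shift n).socleLength = a.socleLength := by
  simp only [socleLength, vertex_shift]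

theorem Arrow.pos_lt (a : Γ.Arrow) : (a.2 : ℕ) < Γ.val a.vertex :=
  a.2.2.trans_eq (length_seq _)

theorem Arrow.shift_pos (a : Γ.Arrow) (n : ℕ) :
    ((a.shift n).2 : ℕ) = (a.2 + n) % Γ.val a.vertex := by
  induction n with
  | zero => exact (Nat.mod_eq_of_lt a.pos_lt).symm
  | succ n ih =>
    rw [shift, next_pos, vertex_shift, ih, Nat.mod_add_mod, add_assoc]

theorem Arrow.shift_shift (a : Γ.Arrow) (m n : ℕ) : (a.shift m).shift n = a.shift (m + n) := by
  induction n with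
  | zero => rfl
  | succ n ih => rw [shift, ih]; rfl

theorem Arrow.shift_next (a : Γ.Arrow) (n : ℕ) : a.next.shift n = a.shift (n + 1) := by
  rw [add_comm]
  exact a.shift_shift 1 n

/-- Shifting adds to the position modulo the valency. All divisibility conditions on central
elements originate here. -/
theorem Arrow.shift_eq_self_iff (a : Γ.Arrow) (n : ℕ) : a.shift n = a ↔ Γ.val a.vertex ∣ n := by
  constructor
  · intro h
    have h1 := a.shift_pos n
    rw [h] at h1
    have h2 : a.2 + n ≡ a.2 + 0 [MOD Γ.val a.vertex] := by
      rw [Nat.ModEq, ← h1, add_zero, Nat.mod_eq_of_lt a.pos_lt]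
    exact (Nat.modEq_zero_iff_dvd).1 (Nat.ModEq.add_left_cancel' _ h2)
  · rintro ⟨k, rfl⟩
    refine ext_pos (a.shift_fst _) ?_
    rw [shift_pos, Nat.add_mul_mod_self_left, Nat.mod_eq_of_lt a.pos_lt]

theorem Arrow.exists_shift_eq {a b : Γ.Arrow} (h : a.1 = b.1) : ∃ n, a.shift n = b := by
  -- The difference of the positions, with a full turn added to keep it a natural number.
  refine ⟨b.2 + (Γ.val a.vertex - a.2), ext_pos ((a.shift_fst _).trans h) ?_⟩
  have h1 := a.pos_lt
  have h2 : (b.2 : ℕ) < Γ.val a.vertex := by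
    exact b.pos_lt.trans_eq (congrArg (fun γ : {α : V // ¬ Γ.Truncated α} => Γ.val γ) h.symm)
  rw [shift_pos, show (a.2 : ℕ) + (b.2 + (Γ.val a.vertex - a.2)) = b.2 + Γ.val a.vertex by omega,
    Nat.add_mod_right, Nat.mod_eq_of_lt h2]

theorem Arrow.next_injective : Function.Injective (Arrow.next : Γ.Arrow → Γ.Arrow) := by
  intro a b h
  have h1 : a.1 = b.1 := (congrArg Sigma.fst h : a.next.1 = b.next.1)
  obtain ⟨α, i⟩ := a
  obtain ⟨β, j⟩ := b
  obtain rfl : α = β := h1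
  have h2 : finRotate _ i = finRotate _ j := eq_of_heq (Sigma.mk.inj h).2
  rw [(finRotate _).injective h2]

/-- The arrow at the same vertex and at the cyclically previous position. -/
def Arrow.prev (a : Γ.Arrow) : Γ.Arrow := a.shift (Γ.val a.vertex - 1)

theorem Arrow.next_prev (a : Γ.Arrow) : a.prev.next = a := by
  change a.shift (Γ.val a.vertex - 1 + 1) = a
  rw [shift_eq_self_iff, Nat.sub_add_cancel (val_pos _)]

theorem Arrow.shift_socleLength (a : Γ.Arrow) : a.shift a.socleLength = a :=
  (a.shift_eq_self_iff _).2 (Dvd.intro _ rfl)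

/-- Thanks to the nontruncated vertex in each polygon, every idempotent is a walk of length zero and
every polygon has a socle element. -/
theorem Arrow.exists_src_eq (p : P) : ∃ a : Γ.Arrow, a.src = p := by
  obtain ⟨α, hα, h⟩ := Γ.exists_nontruncated p
  have h' : ¬ Γ.Truncated α := (ne_of_gt h : Γ.val α * Γ.mult α ≠ 1)
  have hp : p ∈ Γ.seq α := by
    rw [← List.count_pos_iff, Γ.count_seq]
    exact Multiset.count_pos.2 hα
  obtain ⟨i, hi⟩ := List.mem_iff_get.1 hp
  exact ⟨⟨⟨α, h'⟩, i⟩, hi⟩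

/-- The list of the arrows of `a.walk n`. -/
def Arrow.run (a : Γ.Arrow) (n : ℕ) : List Γ.Arrow := (List.range n).map a.shift

theorem Arrow.run_succ (a : Γ.Arrow) (n : ℕ) : a.run (n + 1) = a.run n ++ [a.shift n] := by
  simp [run, List.range_succ]

theorem Arrow.run_succ' (a : Γ.Arrow) (n : ℕ) : a.run (n + 1) = a :: a.next.run n := by
  simp only [run, List.range_succ_eq_map, List.map_cons, List.map_map]
  congr 1
  exact List.map_congr_left fun k _ => (a.shift_next k).symm

@[simp] theorem Arrow.length_run (a : Γ.Arrow) (n : ℕ) : (a.run n).length = n := by simp [run]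

/-- Positivity is essential: an empty run forgets its starting arrow. -/
theorem Arrow.run_inj {a b : Γ.Arrow} {m n : ℕ} (hm : 0 < m) (h : a.run m = b.run n) :
    a = b ∧ m = n := by
  have hl : m = n := by simpa using congrArg List.length h
  subst hl
  obtain ⟨k, rfl⟩ := Nat.exists_eq_succ_of_ne_zero hm.ne'
  rw [Nat.succ_eq_add_one, run_succ', run_succ'] at h
  exact ⟨(List.cons.inj h).1, rfl⟩

theorem Arrow.run_eq_nil {a : Γ.Arrow} {n : ℕ} : a.run n = [] ↔ n = 0 := by
  rw [← List.length_eq_zero_iff, length_run]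

theorem Arrow.self_mem_run (a : Γ.Arrow) {n : ℕ} (hn : 0 < n) : a ∈ a.run n :=
  List.mem_map.2 ⟨0, List.mem_range.2 hn, rfl⟩

theorem Arrow.fst_eq_of_mem_run {a b : Γ.Arrow} {n : ℕ} (h : b ∈ a.run n) : b.1 = a.1 := by
  obtain ⟨k, -, rfl⟩ := List.mem_map.1 h
  exact a.shift_fst k

theorem Arrow.isChain_run (a : Γ.Arrow) (n : ℕ) : (a.run n).IsChain (fun x y => y = x.next) := by
  induction n generalizing a with
  | zero => exact List.isChain_nil
  | succ n ih =>
    rw [run_succ']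
    cases n with
    | zero => exact List.isChain_singleton _
    | succ n =>
      have := ih a.next
      rw [run_succ'] at this ⊢
      exact List.isChain_cons_cons.2 ⟨rfl, this⟩

/-! ### The arrows of a path -/

/-- The list of the arrows of a path. -/
def pathArrows {v : Γ.QuiverVertex} : {w : Γ.QuiverVertex} → Quiver.Path v w → List Γ.Arrow
  | _, .nil => []
  | _, .cons p e => pathArrows p ++ [e.1]

/-- Lists of arrows carry no endpoints in their type, so paths can be compared through them without
casts. -/
theorem pathArrows_comp {u v w : Γ.QuiverVertex} (p : Quiver.Path u v) (q : Quiver.Path v w) :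
    pathArrows (p.comp q) = pathArrows p ++ pathArrows q := by
  induction q with
  | nil => exact (List.append_nil _).symm
  | cons q e ih => simp only [Quiver.Path.comp_cons, pathArrows, ih, List.append_assoc]

theorem pathArrows_toPath {u v : Γ.QuiverVertex} (e : u ⟶ v) : pathArrows e.toPath = [e.1] := rfl

theorem pathArrows_walk (a : Γ.Arrow) (n : ℕ) : pathArrows (a.walk n) = a.run n := by
  induction n with
  | zero => rfl
  | succ n ih => exact (congrArg (· ++ [a.shift n]) ih).trans (a.run_succ n).symm

theorem eq_of_pathArrows_eq_nil {v w : Γ.QuiverVertex} (p : Quiver.Path v w)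
    (h : pathArrows p = []) : v = w := by
  cases p with
  | nil => rfl
  | cons p e => simp [pathArrows] at h

theorem Arrow.exists_walk_two_add (a : Γ.Arrow) (n : ℕ) :
    ∃ q : Quiver.Path a.next.next.start (a.shift (2 + n)).start,
      a.walk (2 + n) = (a.hom.toPath.comp a.next.hom.toPath).comp q := by
  induction n with
  | zero => exact ⟨.nil, rfl⟩
  | succ n ih =>
    obtain ⟨q, hq⟩ := ih
    exact ⟨q.cons (a.shift (2 + n)).hom,
      congrArg (fun r => Quiver.Path.cons r (a.shift (2 + n)).hom) hq⟩

/-- Type three relations are exactly the products of arrows that are not consecutive in the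
orientation. For valency at least two, an arrow and its successor open a special cycle. For valency
one the successor of the loop is itself and the special cycle has length one, which is why its
square needs the explicit exception. -/
theorem relThree_condition_iff {u v w : Γ.QuiverVertex} (e : u ⟶ v) (f : v ⟶ w) :
    ((∀ c : Γ.Arrow, ¬ IsSubpathTwo e f c.specialCycle) ∧
      ¬ (e.1 = f.1 ∧ Γ.val e.1.vertex = 1)) ↔ f.1 ≠ e.1.next := by
  constructor
  · obtain ⟨a, rfl, rfl⟩ := e
    obtain ⟨b, hb, rfl⟩ := f
    rintro ⟨h1, h2⟩ (rfl : b = a.next)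
    obtain h | h := Nat.lt_or_eq_of_le (val_pos (Γ := Γ) a.vertex)
    · refine h1 a ?_
      obtain ⟨n, hn⟩ := Nat.exists_eq_add_of_le h
      obtain ⟨q, hq⟩ := a.exists_walk_two_add n
      have hn' : Γ.val a.vertex = 2 + n := hn
      rw [Arrow.specialCycle, hn']
      exact ⟨.nil, q, hq.trans (Quiver.Path.nil_comp _).symm⟩
    · exact h2 ⟨((a.shift_eq_self_iff 1).2 (by rw [← h])).symm, h.symm⟩
  · refine fun h => ⟨?_, ?_⟩
    · rintro c ⟨p, q, hc⟩
      have h1 := congrArg pathArrows hc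
      rw [Arrow.specialCycle, pathArrows_walk, pathArrows_comp, pathArrows_comp, pathArrows_comp,
        pathArrows_toPath, pathArrows_toPath] at h1
      have h2 := c.isChain_run (Γ.val c.vertex)
      rw [h1] at h2
      have h3 : [e.1, f.1].IsChain (fun x y => y = x.next) :=
        h2.infix ⟨pathArrows p, pathArrows q, by simp⟩
      exact h ((List.isChain_cons_cons.1 h3).1)
    · rintro ⟨h1, h2⟩
      rw [← h1] at h
      exact h ((e.1.shift_eq_self_iff 1).2 (by rw [← h2])).symm

/-! ### Products of walks in the path algebra -/

section PathAlgebra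

variable (K : Type*) [Field K]

/-- The idempotent of the path algebra at a polygon. -/
noncomputable def idemElt (v : Γ.QuiverVertex) : PathAlgebra K Γ.QuiverVertex :=
  PathAlgebra.ofPath K (Quiver.Path.nil : Quiver.Path v v)

/-- An arrow as an element of the path algebra. -/
noncomputable def Arrow.elt (a : Γ.Arrow) : PathAlgebra K Γ.QuiverVertex :=
  PathAlgebra.ofPath K a.hom.toPath

/-- A walk as an element of the path algebra. -/
noncomputable def Arrow.walkElt (a : Γ.Arrow) (n : ℕ) : PathAlgebra K Γ.QuiverVertex :=
  PathAlgebra.ofPath K (a.walk n)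

theorem Arrow.walkElt_zero (a : Γ.Arrow) : a.walkElt K 0 = idemElt K a.start := rfl

theorem Arrow.walkElt_succ (a : Γ.Arrow) (n : ℕ) :
    a.walkElt K (n + 1) = a.walkElt K n * (a.shift n).elt K :=
  (PathAlgebra.ofPath_mul_ofPath K (a.walk n) (a.shift n).hom.toPath).symm

theorem idemElt_mul_ofPath {v w : Γ.QuiverVertex} (p : Quiver.Path v w) :
    idemElt K v * PathAlgebra.ofPath K p = PathAlgebra.ofPath K p := by
  rw [idemElt, PathAlgebra.ofPath_mul_ofPath, Quiver.Path.nil_comp]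

theorem ofPath_mul_idemElt {v w : Γ.QuiverVertex} (p : Quiver.Path v w) :
    PathAlgebra.ofPath K p * idemElt K w = PathAlgebra.ofPath K p := by
  rw [idemElt, PathAlgebra.ofPath_mul_ofPath, Quiver.Path.comp_nil]

theorem Arrow.walkElt_one (a : Γ.Arrow) : a.walkElt K 1 = a.elt K := by
  rw [walkElt_succ, walkElt_zero]
  exact idemElt_mul_ofPath K a.hom.toPath

theorem Arrow.walkElt_mul_walkElt_shift (a : Γ.Arrow) (m n : ℕ) :
    a.walkElt K m * (a.shift m).walkElt K n = a.walkElt K (m + n) := by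
  induction n with
  | zero => exact ofPath_mul_idemElt K (a.walk m)
  | succ n ih => rw [walkElt_succ, ← mul_assoc, ih, shift_shift, ← add_assoc, walkElt_succ]

/-- A special cycle returns to its first arrow, so its powers are longer walks. The zeroth power is
excluded, being the unit of KQ instead of a single idempotent. -/
theorem Arrow.cycleElt_pow (a : Γ.Arrow) (m : ℕ) (hm : 0 < m) :
    a.cycleElt K ^ m = a.walkElt K (Γ.val a.vertex * m) := by
  induction m, hm using Nat.le_induction with
  | base =>
    rw [pow_one, Nat.succ_eq_add_one, Nat.zero_add, mul_one]
    rfl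
  | succ m _ ih =>
    rw [pow_succ, ih, mul_add, mul_one, ← walkElt_mul_walkElt_shift,
      (a.shift_eq_self_iff _).2 (Dvd.intro _ rfl)]
    rfl

theorem Arrow.cycleElt_pow_mult (a : Γ.Arrow) :
    a.cycleElt K ^ Γ.mult a.vertex = a.walkElt K a.socleLength :=
  a.cycleElt_pow K _ (Γ.mult_pos _)

theorem Arrow.mixedCycle_eq (a : Γ.Arrow) :
    a.mixedCycle K = a.next.walkElt K (a.socleLength - 1) := by
  have h1 := val_pos (Γ := Γ) a.vertex
  obtain ⟨m, hm⟩ := Nat.exists_eq_succ_of_ne_zero (Γ.mult_pos a.vertex).ne'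
  have h3 : a.socleLength - 1 = Γ.val a.vertex * m + (Γ.val a.vertex - 1) := by
    rw [socleLength, hm, Nat.mul_succ]
    omega
  rw [mixedCycle, h3, hm, Nat.succ_sub_one]
  -- Multiplicity one is separate because the power is then the unit.
  rcases m.eq_zero_or_pos with rfl | hm0
  · rw [pow_zero, one_mul, mul_zero, zero_add]
    rfl
  · rw [a.next.cycleElt_pow K m hm0, ← walkElt_mul_walkElt_shift, ← vertex_next a,
      (a.next.shift_eq_self_iff _).2 (Dvd.intro _ rfl)]
    rfl

theorem Arrow.idemElt_mul_walkElt (a : Γ.Arrow) (n : ℕ) :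
    idemElt K a.start * a.walkElt K n = a.walkElt K n :=
  idemElt_mul_ofPath K _

theorem Arrow.idemElt_mul_walkElt_of_ne {v : Γ.QuiverVertex} {a : Γ.Arrow} (h : v ≠ a.start)
    (n : ℕ) : idemElt K v * a.walkElt K n = 0 :=
  PathAlgebra.ofPath_mul_ofPath_of_ne K h _ _

theorem Arrow.walkElt_mul_idemElt (a : Γ.Arrow) {v : Γ.QuiverVertex} {n : ℕ}
    (h : (a.shift n).start = v) : a.walkElt K n * idemElt K v = a.walkElt K n := by
  subst h
  exact ofPath_mul_idemElt K _

theorem Arrow.walkElt_mul_idemElt_of_ne (a : Γ.Arrow) {v : Γ.QuiverVertex} {n : ℕ}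
    (h : (a.shift n).start ≠ v) : a.walkElt K n * idemElt K v = 0 :=
  PathAlgebra.ofPath_mul_ofPath_of_ne K h _ _

/-! ### Coefficient functionals -/

variable (Γ) in
/-- Labels of the elements of a basis of the Brauer configuration algebra. -/
inductive Word : Type _
  /-- for the idempotent at a polygon -/
  | idem (p : P) : Word
  /-- for a walk of positive length outside of the socle -/
  | walk (a : Γ.Arrow) (n : ℕ) (h : 0 < n ∧ n < a.socleLength) : Word
  /-- for the socle element at a polygon -/
  | socle (p : P) : Word

/-- The path represents the basis element with the given label. -/
def Word.Represents : Γ.Word → QuiverPath Γ.QuiverVertex → Prop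
  | .idem p, r => r.1 = p ∧ pathArrows r.2.2 = []
  | .walk a n _, r => pathArrows r.2.2 = a.run n
  | .socle p, r => ∃ a : Γ.Arrow, a.src = p ∧ pathArrows r.2.2 = a.run a.socleLength

open Classical in
/-- The functional on the path algebra that sums the coefficients of the paths which represent
a given basis element. -/
noncomputable def Word.coeff (b : Γ.Word) : PathAlgebra K Γ.QuiverVertex →ₗ[K] K :=
  Finsupp.linearCombination K (fun r => if b.Represents r then 1 else 0)

open Classical in
theorem Word.coeff_ofPath (b : Γ.Word) {v w : Γ.QuiverVertex} (p : Quiver.Path v w) :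
    b.coeff K (PathAlgebra.ofPath K p) = if b.Represents ⟨v, w, p⟩ then 1 else 0 := by
  unfold coeff PathAlgebra.ofPath
  erw [Finsupp.linearCombination_single, one_smul]

/-- A path that represents a basis element is a walk of length at most `val(α) μ(α)`. -/
theorem Word.Represents.eq_run {b : Γ.Word} {r : QuiverPath Γ.QuiverVertex}
    (h : b.Represents r) {a : Γ.Arrow} (ha : a ∈ pathArrows r.2.2) :
    ∃ (c : Γ.Arrow) (n : ℕ), n ≤ a.socleLength ∧ pathArrows r.2.2 = c.run n := by
  -- All arrows of a walk belong to one vertex, so the bound may be read off at any of them.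
  have key : ∀ (c : Γ.Arrow) (n : ℕ), pathArrows r.2.2 = c.run n →
      c.socleLength = a.socleLength := by
    intro c n hc
    rw [hc] at ha
    have := Arrow.fst_eq_of_mem_run ha
    simp only [Arrow.socleLength, Arrow.vertex, this]
  cases b with
  | idem p => rw [h.2] at ha; simp at ha
  | walk c n hn => exact ⟨c, n, (key c n h) ▸ hn.2.le, h⟩
  | socle p =>
    obtain ⟨c, -, hc⟩ := h
    exact ⟨c, _, (key c _ hc).le, hc⟩

theorem ofPath_mul_ofPath_cases {u v w x : Γ.QuiverVertex} (p : Quiver.Path u v)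
    (q : Quiver.Path w x) :
    (v ≠ w ∧ PathAlgebra.ofPath K p * PathAlgebra.ofPath K q = 0) ∨
      v = w ∧ ∃ r : Quiver.Path u x, PathAlgebra.ofPath K p * PathAlgebra.ofPath K q =
        PathAlgebra.ofPath K r ∧ pathArrows r = pathArrows p ++ pathArrows q := by
  by_cases h : v = w
  · subst h
    exact .inr ⟨rfl, p.comp q, PathAlgebra.ofPath_mul_ofPath K p q, pathArrows_comp p q⟩
  · exact .inl ⟨h, PathAlgebra.ofPath_mul_ofPath_of_ne K h p q⟩

theorem ofPath_mul_ofPath_mul_ofPath_cases {u v w x y z : Γ.QuiverVertex} (p : Quiver.Path u v)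
    (q : Quiver.Path w x) (s : Quiver.Path y z) :
    PathAlgebra.ofPath K p * PathAlgebra.ofPath K q * PathAlgebra.ofPath K s = 0 ∨
      ∃ r : Quiver.Path u z, PathAlgebra.ofPath K p * PathAlgebra.ofPath K q *
        PathAlgebra.ofPath K s = PathAlgebra.ofPath K r ∧
        pathArrows r = pathArrows p ++ pathArrows q ++ pathArrows s := by
  obtain ⟨-, h⟩ | ⟨-, r, h, hr⟩ := ofPath_mul_ofPath_cases K p q
  · exact .inl (by rw [h, zero_mul])
  · obtain ⟨-, h'⟩ | ⟨-, r', h', hr'⟩ := ofPath_mul_ofPath_cases K r s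
    · exact .inl (by rw [h, h'])
    · exact .inr ⟨r', by rw [h, h'], by rw [hr', hr]⟩

/-- A path in which two arrows follow each other that are not neighbours in the orientation, or
whose length exceeds that of the socle, has no nonzero coefficients. -/
theorem Word.coeff_mul_mul_eq_zero (b : Γ.Word) {u v w x y z : Γ.QuiverVertex}
    (p : Quiver.Path u v) (q : Quiver.Path w x) (s : Quiver.Path y z) (a : Γ.Arrow)
    (ha : a ∈ pathArrows q)
    (h : a.socleLength < (pathArrows p).length + (pathArrows q).length + (pathArrows s).length ∨
      ¬ (pathArrows q).IsChain (fun x y => y = x.next)) :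
    b.coeff K (PathAlgebra.ofPath K p * PathAlgebra.ofPath K q * PathAlgebra.ofPath K s) = 0 := by
  obtain h0 | ⟨r, h0, hr⟩ := ofPath_mul_ofPath_mul_ofPath_cases K p q s
  · rw [h0, map_zero]
  · rw [h0, coeff_ofPath, if_neg]
    intro hb
    obtain ⟨c, n, hn, hc⟩ := hb.eq_run (a := a) (by simp [hr, ha])
    simp only [hr] at hc
    rcases h with h | h
    · have := congrArg List.length hc
      simp at this
      omega
    · have := c.isChain_run n
      rw [← hc] at this
      exact h (this.infix ⟨_, _, rfl⟩)

/-- A walk of full length represents the socle word of its start and no other word; this depends on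
the polygon alone. -/
theorem Word.coeff_walkElt_socleLength (b : Γ.Word) {a c : Γ.Arrow} (h : a.src = c.src) :
    b.coeff K (a.walkElt K a.socleLength) = b.coeff K (c.walkElt K c.socleLength) := by
  have key : ∀ a : Γ.Arrow, b.Represents ⟨_, _, a.walk a.socleLength⟩ ↔ b = .socle a.src := by
    intro a
    have ha := a.two_le_socleLength
    cases b with
    | idem p => simp [Represents, pathArrows_walk, Arrow.run_eq_nil]; omega
    | walk c n hn =>
      simp only [Represents, pathArrows_walk, reduceCtorEq, iff_false]
      intro h
      obtain ⟨rfl, rfl⟩ := Arrow.run_inj (by omega) h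
      omega
    | socle p =>
      simp only [Represents, pathArrows_walk, Word.socle.injEq]
      constructor
      · rintro ⟨c, rfl, hc⟩
        rw [(Arrow.run_inj (by omega) hc).1]
      · rintro rfl
        exact ⟨a, rfl, rfl⟩
  rw [Arrow.walkElt, Arrow.walkElt, coeff_ofPath, coeff_ofPath]
  classical exact if_congr ((key a).trans (h ▸ (key c).symm)) rfl rfl

/-- If `p` or `q` is nontrivial, both products exceed the socle length and have no coefficients. If
both are trivial, the idempotents keep or kill both full cycles alike, since these are closed at the
same polygon. -/
theorem Word.coeff_mul_sub_mul (b : Γ.Word) {a c : Γ.Arrow} (h : a.src = c.src)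
    {u v w x : Γ.QuiverVertex} (p : Quiver.Path u v) (q : Quiver.Path w x) :
    b.coeff K (PathAlgebra.ofPath K p * (a.walkElt K a.socleLength) * PathAlgebra.ofPath K q) =
      b.coeff K (PathAlgebra.ofPath K p * c.walkElt K c.socleLength * PathAlgebra.ofPath K q) := by
  by_cases hpq : (pathArrows p).length + (pathArrows q).length = 0
  · have hp : pathArrows p = [] := List.length_eq_zero_iff.1 (by omega)
    have hq : pathArrows q = [] := List.length_eq_zero_iff.1 (by omega)
    obtain rfl := eq_of_pathArrows_eq_nil p hp
    obtain rfl := eq_of_pathArrows_eq_nil q hq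
    cases p with
    | cons p e => simp [pathArrows] at hp
    | nil =>
    cases q with
    | cons q e => simp [pathArrows] at hq
    | nil =>
    change b.coeff K (idemElt K u * _ * idemElt K w) = b.coeff K (idemElt K u * _ * idemElt K w)
    by_cases hu : u = c.start
    · by_cases hw : c.start = w
      · have key : ∀ a : Γ.Arrow, a.start = u → a.start = w →
            idemElt K u * a.walkElt K a.socleLength * idemElt K w = a.walkElt K a.socleLength := by
          rintro a rfl rfl
          rw [Arrow.idemElt_mul_walkElt, a.walkElt_mul_idemElt K (by rw [a.shift_socleLength])]
        rw [key a (Eq.trans h hu.symm) (Eq.trans h hw), key c hu.symm hw]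
        exact b.coeff_walkElt_socleLength K h
      · rw [mul_assoc, mul_assoc, c.walkElt_mul_idemElt_of_ne K (by rwa [c.shift_socleLength]),
          a.walkElt_mul_idemElt_of_ne K (by
            rw [a.shift_socleLength]
            exact fun h' => hw (Eq.trans (Eq.symm h) h'))]
    · rw [Arrow.idemElt_mul_walkElt_of_ne K hu,
        Arrow.idemElt_mul_walkElt_of_ne K (fun h' => hu (h'.trans h))]
  · have key : ∀ a : Γ.Arrow, b.coeff K (PathAlgebra.ofPath K p * (a.walkElt K a.socleLength) *
        PathAlgebra.ofPath K q) = 0 := by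
      intro a
      refine b.coeff_mul_mul_eq_zero K p _ q a ?_ (.inl ?_)
      · rw [pathArrows_walk]
        exact a.self_mem_run (by have := a.two_le_socleLength; omega)
      · rw [pathArrows_walk, Arrow.length_run]
        omega
    rw [key, key]

end PathAlgebra

/-! ### A basis of the Brauer configuration algebra -/

section Algebra

variable (K : Type*) [Field K]

theorem Word.coeff_mul_mul_eq_zero_of_paths (b : Γ.Word) {x : PathAlgebra K Γ.QuiverVertex}
    (h : ∀ (u v w y : Γ.QuiverVertex) (p : Quiver.Path u v) (q : Quiver.Path w y),
      b.coeff K (PathAlgebra.ofPath K p * x * PathAlgebra.ofPath K q) = 0)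
    (y z : PathAlgebra K Γ.QuiverVertex) : b.coeff K (y * x * z) = 0 := by
  induction y using PathAlgebra.induction_paths with
  | h0 => rw [zero_mul, zero_mul, map_zero]
  | hadd y y' hy hy' => rw [add_mul, add_mul, map_add, hy, hy', add_zero]
  | hpath c _ _ p =>
    induction z using PathAlgebra.induction_paths with
    | h0 => rw [mul_zero, map_zero]
    | hadd z z' hz hz' => rw [mul_add, map_add, hz, hz', add_zero]
    | hpath d _ _ q =>
      rw [smul_mul_assoc, smul_mul_assoc, mul_smul_comm, map_smul, map_smul, h, smul_zero,
        smul_zero]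

theorem Word.coeff_mul_relation_mul (b : Γ.Word) {x : PathAlgebra K Γ.QuiverVertex}
    (hx : x ∈ Γ.relOne K ∪ Γ.relTwo K ∪ Γ.relThree K) (y z : PathAlgebra K Γ.QuiverVertex) :
    b.coeff K (y * x * z) = 0 := by
  refine b.coeff_mul_mul_eq_zero_of_paths K (fun u v w t p q => ?_) y z
  obtain (⟨a, c, hac, rfl⟩ | ⟨a, rfl⟩) | ⟨u', v', w', e, f, h1, h2, rfl⟩ := hx
  · rw [a.cycleElt_pow_mult K, c.cycleElt_pow_mult K, mul_sub, sub_mul, map_sub,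
      b.coeff_mul_sub_mul K hac, sub_self]
  · have h : a.cycleElt K ^ Γ.mult a.vertex * PathAlgebra.ofPath K a.hom.toPath =
        a.walkElt K (a.socleLength + 1) := by
      rw [a.cycleElt_pow_mult K, Arrow.walkElt_succ, a.shift_socleLength]
      rfl
    rw [h]
    refine b.coeff_mul_mul_eq_zero K p _ q a ?_ (.inl ?_)
    · rw [pathArrows_walk]
      exact a.self_mem_run (Nat.succ_pos _)
    · rw [pathArrows_walk, Arrow.length_run]
      omega
  · have h := (relThree_condition_iff e f).1 ⟨h1, h2⟩
    have h' : pathArrows (e.toPath.comp f.toPath) = [e.1, f.1] := rfl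
    refine b.coeff_mul_mul_eq_zero K p _ q e.1 ?_ (.inr ?_)
    · rw [h']
      exact List.mem_cons_self
    · rw [h']
      exact fun hc => h ((List.isChain_cons_cons.1 hc).1)

theorem Word.coeff_eq_zero_of_mem (b : Γ.Word) {x : PathAlgebra K Γ.QuiverVertex}
    (hx : x ∈ Γ.relIdeal K) : b.coeff K x = 0 := by
  -- The two-sided form is stable under multiplication by ring elements, so induction over the
  -- generated ideal goes through.
  suffices h : ∀ y z, b.coeff K (y * x * z) = 0 by simpa using h 1 1
  unfold relIdeal at hx
  induction hx using TwoSidedIdeal.span_induction with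
  | mem x hx => exact b.coeff_mul_relation_mul K hx
  | zero => intro y z; rw [mul_zero, zero_mul, map_zero]
  | add x x' _ _ hx hx' => intro y z; rw [mul_add, add_mul, map_add, hx, hx', add_zero]
  | neg x _ hx => intro y z; rw [mul_neg, neg_mul, map_neg, hx, neg_zero]
  | left_absorb t x _ hx => intro y z; rw [← mul_assoc, hx]
  | right_absorb t x _ hx => intro y z; rw [← mul_assoc, mul_assoc (y * x), hx]

/-! ### Passage to the quotient and multiplication of walk classes -/

theorem proj_eq_zero_iff {x : PathAlgebra K Γ.QuiverVertex} :
    Γ.proj K x = 0 ↔ x ∈ Γ.relIdeal K :=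
  ((Γ.relIdeal K).ringCon.eq (a := x) (b := 0)).trans (TwoSidedIdeal.mem_iff _ x).symm

theorem proj_smul (c : K) (x : PathAlgebra K Γ.QuiverVertex) :
    Γ.proj K (c • x) = c • Γ.proj K x := rfl

theorem proj_surjective : Function.Surjective (Γ.proj K) := RingCon.mk'_surjective _

/-- The coordinate functional of a basis element of the Brauer configuration algebra. -/
noncomputable def Word.coord (b : Γ.Word) : Γ.Alg K →ₗ[K] K where
  toFun := Quotient.lift (b.coeff K) fun x y h => by
    rw [← sub_eq_zero, ← map_sub]
    exact b.coeff_eq_zero_of_mem K ((TwoSidedIdeal.rel_iff _ x y).1 h)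
  map_add' x y := by
    obtain ⟨x, rfl⟩ := proj_surjective K x
    obtain ⟨y, rfl⟩ := proj_surjective K y
    exact (b.coeff K).map_add x y
  map_smul' c x := by
    obtain ⟨x, rfl⟩ := proj_surjective K x
    exact (b.coeff K).map_smul c x

theorem Word.coord_proj (b : Γ.Word) (x : PathAlgebra K Γ.QuiverVertex) :
    b.coord K (Γ.proj K x) = b.coeff K x := rfl

/-- The class of an idempotent in the Brauer configuration algebra. -/
noncomputable def idemClass (v : Γ.QuiverVertex) : Γ.Alg K := Γ.proj K (idemElt K v)

/-- The class of a walk in the Brauer configuration algebra. -/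
noncomputable def Arrow.walkClass (a : Γ.Arrow) (n : ℕ) : Γ.Alg K := Γ.proj K (a.walkElt K n)

theorem Arrow.walkClass_zero (a : Γ.Arrow) : a.walkClass K 0 = idemClass K a.start := rfl

theorem Arrow.walkClass_mul_shift (a : Γ.Arrow) (m n : ℕ) :
    a.walkClass K m * (a.shift m).walkClass K n = a.walkClass K (m + n) := by
  rw [walkClass, walkClass, ← map_mul, walkElt_mul_walkElt_shift]
  rfl

theorem Arrow.walkClass_socleLength {a b : Γ.Arrow} (h : a.src = b.src) :
    a.walkClass K a.socleLength = b.walkClass K b.socleLength := by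
  rw [← sub_eq_zero, walkClass, walkClass, ← map_sub, proj_eq_zero_iff, ← cycleElt_pow_mult,
    ← cycleElt_pow_mult]
  exact TwoSidedIdeal.subset_span (.inl (.inl ⟨a, b, h, rfl⟩))

theorem Arrow.walkClass_eq_zero (a : Γ.Arrow) {n : ℕ} (h : a.socleLength < n) :
    a.walkClass K n = 0 := by
  obtain ⟨k, rfl⟩ := Nat.exists_eq_add_of_lt h
  have h0 : a.walkClass K (a.socleLength + 1) = 0 := by
    rw [walkClass, proj_eq_zero_iff, walkElt_succ, a.shift_socleLength, ← cycleElt_pow_mult]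
    exact TwoSidedIdeal.subset_span (.inl (.inr ⟨a, rfl⟩))
  rw [add_right_comm, ← walkClass_mul_shift, h0, zero_mul]

theorem Arrow.walkClass_one_mul_walkClass_one {a b : Γ.Arrow} (h : b ≠ a.next) :
    a.walkClass K 1 * b.walkClass K 1 = 0 := by
  rw [walkClass, walkClass, walkElt_one, walkElt_one, ← map_mul]
  by_cases hab : a.next.start = b.start
  · rw [proj_eq_zero_iff]
    -- Transports `b` to an edge that literally starts where `a` ends, so that the two can be
    -- composed.
    obtain ⟨e, he⟩ : ∃ e : a.next.start ⟶ b.next.start,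
        e.1 = b ∧ b.elt K = PathAlgebra.ofPath K e.toPath := by
      rw [hab]
      exact ⟨b.hom, rfl, rfl⟩
    rw [he.2, elt, PathAlgebra.ofPath_mul_ofPath]
    have := (relThree_condition_iff a.hom e).2 (he.1.trans_ne h)
    exact TwoSidedIdeal.subset_span (.inr ⟨_, _, _, _, _, this.1, this.2, rfl⟩)
  · rw [elt, elt, PathAlgebra.ofPath_mul_ofPath_of_ne K hab, map_zero]

/-- At the junction, the last arrow of the first walk meets an arrow that is not its successor. With
`walkClass_mul_shift` this is the multiplication table for walks of positive length. -/
theorem Arrow.walkClass_mul_walkClass {a b : Γ.Arrow} {m n : ℕ} (hm : 0 < m) (hn : 0 < n)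
    (h : b ≠ a.shift m) : a.walkClass K m * b.walkClass K n = 0 := by
  obtain ⟨m, rfl⟩ := Nat.exists_eq_add_of_le' hm
  obtain ⟨n, rfl⟩ := Nat.exists_eq_add_of_le hn
  rw [← walkClass_mul_shift, ← walkClass_mul_shift, mul_assoc, ← mul_assoc (walkClass K _ 1),
    walkClass_one_mul_walkClass_one K h, zero_mul, mul_zero]

theorem Arrow.idemClass_mul_walkClass (a : Γ.Arrow) (n : ℕ) :
    idemClass K a.start * a.walkClass K n = a.walkClass K n := by
  rw [walkClass, idemClass, ← map_mul, idemElt_mul_walkElt]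

theorem Arrow.idemClass_mul_walkClass_of_ne {v : Γ.QuiverVertex} {a : Γ.Arrow} (h : v ≠ a.start)
    (n : ℕ) : idemClass K v * a.walkClass K n = 0 := by
  rw [walkClass, idemClass, ← map_mul, idemElt_mul_walkElt_of_ne K h, map_zero]

theorem Arrow.walkClass_mul_idemClass (a : Γ.Arrow) {v : Γ.QuiverVertex} {n : ℕ}
    (h : (a.shift n).start = v) : a.walkClass K n * idemClass K v = a.walkClass K n := by
  rw [walkClass, idemClass, ← map_mul, walkElt_mul_idemElt K a h]

theorem Arrow.walkClass_mul_idemClass_of_ne (a : Γ.Arrow) {v : Γ.QuiverVertex} {n : ℕ}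
    (h : (a.shift n).start ≠ v) : a.walkClass K n * idemClass K v = 0 := by
  rw [walkClass, idemClass, ← map_mul, walkElt_mul_idemElt_of_ne K a h, map_zero]

theorem proj_ofPath_cons {u v w : Γ.QuiverVertex} (p : Quiver.Path u v) (e : v ⟶ w) :
    Γ.proj K (PathAlgebra.ofPath K (p.cons e)) =
      Γ.proj K (PathAlgebra.ofPath K p) * e.1.walkClass K 1 := by
  obtain ⟨a, rfl, rfl⟩ := e
  rw [Arrow.walkClass, Arrow.walkElt_one, ← map_mul]
  exact congrArg _ (PathAlgebra.ofPath_mul_ofPath K p a.hom.toPath).symm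

theorem proj_ofPath_eq_zero_or {u v : Γ.QuiverVertex} (p : Quiver.Path u v) :
    Γ.proj K (PathAlgebra.ofPath K p) = 0 ∨
      ∃ (a : Γ.Arrow) (n : ℕ), Γ.proj K (PathAlgebra.ofPath K p) = a.walkClass K n := by
  induction p with
  | nil =>
    obtain ⟨a, rfl⟩ := Arrow.exists_src_eq (Γ := Γ) u
    exact .inr ⟨a, 0, rfl⟩
  | cons p e ih =>
    rw [proj_ofPath_cons]
    obtain h | ⟨a, n, h⟩ := ih
    · exact .inl (by rw [h, zero_mul])
    · rw [h]
      by_cases he : e.1 = a.shift n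
      · exact .inr ⟨a, n + 1, by rw [he, Arrow.walkClass_mul_shift]⟩
      -- A trivial walk remembers only its polygon, so it can still be extended by an arrow other
      -- than `a`.
      · rcases n.eq_zero_or_pos with rfl | hn
        · rw [Arrow.walkClass_zero]
          by_cases hs : a.start = e.1.start
          · exact .inr ⟨e.1, 1, by rw [hs, Arrow.idemClass_mul_walkClass]⟩
          · exact .inl (Arrow.idemClass_mul_walkClass_of_ne K hs 1)
        · exact .inl (Arrow.walkClass_mul_walkClass K hn one_pos he)

/-- The class in the socle at a polygon. -/
noncomputable def socleClass (p : P) : Γ.Alg K :=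
  (Arrow.exists_src_eq (Γ := Γ) p).choose.walkClass K
    (Arrow.exists_src_eq (Γ := Γ) p).choose.socleLength

theorem socleClass_src (a : Γ.Arrow) : socleClass K a.src = a.walkClass K a.socleLength :=
  Arrow.walkClass_socleLength K (Arrow.exists_src_eq (Γ := Γ) a.src).choose_spec

/-- The elements of the standard basis of the Brauer configuration algebra. -/
noncomputable def Word.toAlg : Γ.Word → Γ.Alg K
  | .idem p => idemClass (Γ := Γ) K p
  | .walk a n _ => a.walkClass K n
  | .socle p => socleClass K p

theorem Arrow.walkClass_mem_span (a : Γ.Arrow) (n : ℕ) :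
    a.walkClass K n ∈ Submodule.span K (Set.range (Word.toAlg (Γ := Γ) K)) := by
  rcases n.eq_zero_or_pos with rfl | hn
  · exact Submodule.subset_span ⟨.idem a.src, rfl⟩
  obtain h | rfl | h := lt_trichotomy n a.socleLength
  · exact Submodule.subset_span ⟨.walk a n ⟨hn, h⟩, rfl⟩
  · exact Submodule.subset_span ⟨.socle a.src, socleClass_src K a⟩
  · rw [a.walkClass_eq_zero K h]
    exact Submodule.zero_mem _

theorem mem_span_range_toAlg (x : Γ.Alg K) :
    x ∈ Submodule.span K (Set.range (Word.toAlg (Γ := Γ) K)) := by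
  obtain ⟨x, rfl⟩ := proj_surjective K x
  induction x using PathAlgebra.induction_paths with
  | h0 => rw [map_zero]; exact Submodule.zero_mem _
  | hadd x y hx hy => rw [map_add]; exact Submodule.add_mem _ hx hy
  | hpath c v w p =>
    rw [proj_smul]
    refine Submodule.smul_mem _ _ ?_
    obtain h | ⟨a, n, h⟩ := proj_ofPath_eq_zero_or K p
    · rw [h]; exact Submodule.zero_mem _
    · rw [h]; exact a.walkClass_mem_span K n

/-! ### Duality between the standard basis and the coordinates -/

theorem Word.coord_idem_walkClass (p : P) (a : Γ.Arrow) {n : ℕ} (hn : 0 < n) :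
    (Word.idem p : Γ.Word).coord K (a.walkClass K n) = 0 := by
  rw [Arrow.walkClass, coord_proj, Arrow.walkElt, coeff_ofPath, if_neg]
  rintro ⟨-, h⟩
  rw [pathArrows_walk, Arrow.run_eq_nil] at h
  omega

open Classical in
theorem Word.coord_walk_walkClass (a c : Γ.Arrow) (n m : ℕ) (h) :
    (Word.walk a n h : Γ.Word).coord K (c.walkClass K m) = if a = c ∧ n = m then 1 else 0 := by
  rw [Arrow.walkClass, coord_proj, Arrow.walkElt, coeff_ofPath]
  refine if_congr ?_ rfl rfl
  simp only [Represents, pathArrows_walk]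
  constructor
  · intro h'
    exact Arrow.run_inj h.1 h'.symm
  · rintro ⟨rfl, rfl⟩
    rfl

open Classical in
theorem Word.coord_socle_walkClass (p : P) (a : Γ.Arrow) (n : ℕ) :
    (Word.socle p : Γ.Word).coord K (a.walkClass K n) =
      if a.src = p ∧ n = a.socleLength then 1 else 0 := by
  rw [Arrow.walkClass, coord_proj, Arrow.walkElt, coeff_ofPath]
  refine if_congr ?_ rfl rfl
  simp only [Represents, pathArrows_walk]
  constructor
  · rintro ⟨c, rfl, h⟩
    obtain ⟨rfl, rfl⟩ := Arrow.run_inj (by have := c.two_le_socleLength; omega) h.symm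
    exact ⟨rfl, rfl⟩
  · rintro ⟨rfl, rfl⟩
    exact ⟨a, rfl, rfl⟩

open Classical in
theorem Word.coord_idem_idemClass (p : P) (v : Γ.QuiverVertex) :
    (Word.idem p : Γ.Word).coord K (idemClass K v) = if v = p then 1 else 0 := by
  rw [idemClass, coord_proj, idemElt, coeff_ofPath]
  refine if_congr ?_ rfl rfl
  exact and_iff_left rfl

theorem Word.coord_walk_idemClass (a : Γ.Arrow) (n : ℕ) (h) (v : Γ.QuiverVertex) :
    (Word.walk a n h : Γ.Word).coord K (idemClass K v) = 0 := by
  rw [idemClass, coord_proj, idemElt, coeff_ofPath, if_neg]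
  intro h'
  exact h.1.ne' (Arrow.run_eq_nil.1 (Eq.symm h'))

theorem Word.coord_socle_idemClass (p : P) (v : Γ.QuiverVertex) :
    (Word.socle p : Γ.Word).coord K (idemClass K v) = 0 := by
  rw [idemClass, coord_proj, idemElt, coeff_ofPath, if_neg]
  rintro ⟨a, -, h⟩
  have := Arrow.run_eq_nil.1 (Eq.symm h)
  have := a.two_le_socleLength
  omega

open Classical in
theorem Word.coord_toAlg (b c : Γ.Word) : b.coord K (c.toAlg K) = if b = c then 1 else 0 := by
  have key : ∀ p : P, ∃ a : Γ.Arrow, a.src = p ∧ socleClass K p = a.walkClass K a.socleLength := by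
    intro p
    obtain ⟨a, rfl⟩ := Arrow.exists_src_eq (Γ := Γ) p
    exact ⟨a, rfl, socleClass_src K a⟩
  rcases c with p | ⟨c, m, hm⟩ | p
  · rcases b with q | ⟨a, n, hn⟩ | q
    · refine (coord_idem_idemClass K q p).trans (if_congr ?_ rfl rfl)
      rw [Word.idem.injEq]
      exact eq_comm
    · exact (coord_walk_idemClass K a n hn p).trans (by simp)
    · exact (coord_socle_idemClass K q p).trans (by simp)
  · rcases b with q | ⟨a, n, hn⟩ | q
    · exact (coord_idem_walkClass K q c hm.1).trans (by simp)
    · exact (coord_walk_walkClass K a c n m hn).trans (by simp)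
    · refine (coord_socle_walkClass K q c m).trans ?_
      rw [if_neg (by omega), if_neg (by simp)]
  · obtain ⟨c, rfl, hc⟩ := key p
    change b.coord K (socleClass K c.src) = _
    rw [hc]
    have := c.two_le_socleLength
    rcases b with q | ⟨a, n, hn⟩ | q
    · exact (coord_idem_walkClass K q c (by omega)).trans (by simp)
    · refine (coord_walk_walkClass K a c n _ hn).trans ?_
      rw [if_neg (by rintro ⟨rfl, rfl⟩; omega), if_neg (by simp)]
    · refine (coord_socle_walkClass K q c _).trans (if_congr ?_ rfl rfl)
      simp [eq_comm]

/-- By duality, the coordinates are the coefficients in any expansion of `x` in the spanning words.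
-/
theorem eq_zero_of_coord_eq_zero {x : Γ.Alg K} (h : ∀ b : Γ.Word, b.coord K x = 0) : x = 0 := by
  classical
  obtain ⟨f, rfl⟩ := (Finsupp.mem_span_range_iff_exists_finsupp).1 (mem_span_range_toAlg K x)
  refine Finset.sum_eq_zero fun c hc => ?_
  have h1 := h c
  rw [Finsupp.sum, map_sum, Finset.sum_eq_single c] at h1
  · rw [map_smul, Word.coord_toAlg, if_pos rfl, smul_eq_mul, mul_one] at h1
    exact absurd h1 (Finsupp.mem_support_iff.1 hc)
  · intro d _ hd
    rw [map_smul, Word.coord_toAlg, if_neg hd.symm, smul_zero]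
  · exact fun h' => absurd hc h'

end Algebra

/-! ### Central elements -/

section Center

variable (K : Type*) [Field K]

theorem mem_center_of_commute {z : Γ.Alg K} (h : ∀ v, idemClass K v * z = z * idemClass K v)
    (h' : ∀ a : Γ.Arrow, a.walkClass K 1 * z = z * a.walkClass K 1) :
    z ∈ Subalgebra.center K (Γ.Alg K) := by
  rw [Subalgebra.mem_center_iff]
  intro y
  obtain ⟨y, rfl⟩ := proj_surjective K y
  induction y using PathAlgebra.induction_paths with
  | h0 => rw [map_zero, zero_mul, mul_zero]
  | hadd x y hx hy => rw [map_add, add_mul, mul_add, hx, hy]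
  | hpath c v w p =>
    rw [proj_smul, smul_mul_assoc, mul_smul_comm]
    congr 1
    induction p with
    | nil => exact h v
    | cons p e ih => rw [proj_ofPath_cons, mul_assoc, h', ← mul_assoc, ih, mul_assoc]

theorem Arrow.walkClass_commute_idemClass (a : Γ.Arrow) {n : ℕ} (h : (a.shift n).src = a.src)
    (v : Γ.QuiverVertex) : idemClass K v * a.walkClass K n = a.walkClass K n * idemClass K v := by
  by_cases hv : v = a.start
  · subst hv
    exact (a.idemClass_mul_walkClass K n).trans (a.walkClass_mul_idemClass K h).symm
  · rw [idemClass_mul_walkClass_of_ne K hv, a.walkClass_mul_idemClass_of_ne K]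
    exact fun h' => hv (h'.symm.trans h)

theorem socleClass_mem_center (p : P) :
    socleClass (Γ := Γ) K p ∈ Subalgebra.center K (Γ.Alg K) := by
  obtain ⟨a, rfl⟩ := Arrow.exists_src_eq (Γ := Γ) p
  rw [socleClass_src]
  have ha := a.two_le_socleLength
  refine mem_center_of_commute K (a.walkClass_commute_idemClass K (by rw [a.shift_socleLength]))
    fun x => ?_
  trans 0
  · by_cases h : a = x.next
    · subst h
      exact (x.walkClass_mul_shift K 1 _).trans (x.walkClass_eq_zero K (by
        have := x.socleLength_shift 1
        change x.socleLength < 1 + (x.shift 1).socleLength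
        omega))
    · exact Arrow.walkClass_mul_walkClass K one_pos (by omega) h
  · symm
    by_cases h : x = a.shift a.socleLength
    · rw [h, a.walkClass_mul_shift K, a.walkClass_eq_zero K (Nat.lt_succ_self _)]
    · exact Arrow.walkClass_mul_walkClass K (by omega) one_pos h

theorem Arrow.shift_next_socleLength_sub_one (a : Γ.Arrow) :
    a.next.shift (a.socleLength - 1) = a := by
  rw [shift_next, Nat.sub_add_cancel (by have := a.two_le_socleLength; omega), shift_socleLength]

/-- Only the missing arrow `a` has a nonzero product with this walk. Completing it on either side
gives full cycles starting at `a` and at `a.next`, which agree in the socle because `a` is a loop.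
-/
theorem Arrow.mixed_mem_center (a : Γ.Arrow) (h : a.src = a.tgt) :
    a.next.walkClass K (a.socleLength - 1) ∈ Subalgebra.center K (Γ.Alg K) := by
  have ha := a.two_le_socleLength
  have hs := a.shift_next_socleLength_sub_one
  refine mem_center_of_commute K (a.next.walkClass_commute_idemClass K (by rw [hs]; exact h))
    fun x => ?_
  by_cases hx : x = a
  · subst hx
    have h1 := x.walkClass_mul_shift K 1 (x.socleLength - 1)
    have h2 := x.next.walkClass_mul_shift K (x.socleLength - 1) 1
    rw [hs, Nat.sub_add_cancel (by omega)] at h2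
    rw [Nat.add_sub_cancel' (by omega)] at h1
    exact h1.trans ((walkClass_socleLength K h).trans h2.symm)
  · rw [walkClass_mul_walkClass K one_pos (by omega) (fun h' => hx (next_injective h'.symm)),
      walkClass_mul_walkClass K (by omega) one_pos (by rwa [hs])]

/-- The arrow at a given position of the orientation at a nontruncated vertex. -/
abbrev arrowAt (α : {α : V // ¬ Γ.Truncated α}) (i : Fin (Γ.seq α).length) : Γ.Arrow := ⟨α, i⟩

theorem sumCycles_eq (α : {α : V // ¬ Γ.Truncated α}) :
    Γ.sumCycles K α = ∑ i : Fin (Γ.seq α).length,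
      (arrowAt α i).walkClass K (Γ.val α) := rfl

theorem shift_val_mul (α : {α : V // ¬ Γ.Truncated α}) (i : Fin (Γ.seq α).length) (j : ℕ) :
    (arrowAt α i).shift (Γ.val α * j) = arrowAt α i :=
  (Arrow.shift_eq_self_iff _ _).2 (Dvd.intro _ rfl)

/-- Cross terms vanish: a special cycle can only be continued by its own first arrow. -/
theorem sumCycles_pow (α : {α : V // ¬ Γ.Truncated α}) {j : ℕ} (hj : 1 ≤ j) :
    Γ.sumCycles K α ^ j = ∑ i : Fin (Γ.seq α).length,
      (arrowAt α i).walkClass K (Γ.val α * j) := by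
  have hv := val_pos (Γ := Γ) α
  induction j, hj using Nat.le_induction with
  | base => rw [pow_one, sumCycles_eq, mul_one]
  | succ j hj ih =>
    rw [pow_succ, ih, sumCycles_eq, Finset.sum_mul_sum]
    refine Finset.sum_congr rfl fun i _ => ?_
    rw [Finset.sum_eq_single i]
    · have := (arrowAt α i).walkClass_mul_shift K (Γ.val α * j) (Γ.val α)
      rwa [shift_val_mul] at this
    · intro k _ hk
      refine Arrow.walkClass_mul_walkClass K (Nat.mul_pos hv hj) hv ?_
      rw [shift_val_mul]
      exact fun h => hk (eq_of_heq (Sigma.mk.inj h).2)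
    · simp

theorem sumCycles_mem_center (α : {α : V // ¬ Γ.Truncated α}) :
    Γ.sumCycles K α ∈ Subalgebra.center K (Γ.Alg K) := by
  have hv := val_pos (Γ := Γ) α
  have hs : ∀ i, (arrowAt α i).shift (Γ.val α) = arrowAt α i := fun i =>
    (Arrow.shift_eq_self_iff _ _).2 dvd_rfl
  rw [sumCycles_eq]
  refine mem_center_of_commute K (fun v => ?_) fun x => ?_
  · rw [Finset.mul_sum, Finset.sum_mul]
    exact Finset.sum_congr rfl fun i _ =>
      Arrow.walkClass_commute_idemClass K _ (by rw [hs]) v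
  · rw [Finset.mul_sum, Finset.sum_mul]
    by_cases hx : x.1 = α
    · obtain ⟨β, k⟩ := x
      obtain rfl : β = α := hx
      -- From the left the arrow meets only the cycle at the next position, from the right only its
      -- own; both products are the same walk of length val + 1.
      rw [Finset.sum_eq_single (finRotate _ k), Finset.sum_eq_single k]
      · have h1 := (arrowAt β k).walkClass_mul_shift K 1 (Γ.val β)
        have h2 := (arrowAt β k).walkClass_mul_shift K (Γ.val β) 1
        rw [hs] at h2
        rw [h2, add_comm]
        exact h1
      · intro i _ hi
        refine Arrow.walkClass_mul_walkClass K hv one_pos ?_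
        rw [hs]
        exact fun h => hi (eq_of_heq (Sigma.mk.inj h).2).symm
      · simp
      · intro i _ hi
        refine Arrow.walkClass_mul_walkClass K one_pos hv ?_
        exact fun h => hi (eq_of_heq (Sigma.mk.inj h).2)
      · simp
    · rw [Finset.sum_eq_zero, Finset.sum_eq_zero]
      · intro i _
        refine Arrow.walkClass_mul_walkClass K hv one_pos ?_
        rw [hs]
        exact fun h => hx (congrArg Sigma.fst h)
      · intro i _
        refine Arrow.walkClass_mul_walkClass K one_pos hv ?_
        exact fun h => hx (congrArg Sigma.fst h).symm

/-! ### Coordinates of central elements -/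

variable {K} in
-- Idempotents and socle elements are walk classes too, so coordinates of products need only be
-- checked on walks.
theorem linearMap_ext_walkClass {f g : Γ.Alg K →ₗ[K] K}
    (h : ∀ (a : Γ.Arrow) (n : ℕ), f (a.walkClass K n) = g (a.walkClass K n)) (z : Γ.Alg K) :
    f z = g z := by
  have hz := mem_span_range_toAlg K z
  induction hz using Submodule.span_induction with
  | mem x hx =>
    obtain ⟨p | ⟨a, n, -⟩ | p, rfl⟩ := hx
    · obtain ⟨a, rfl⟩ := Arrow.exists_src_eq (Γ := Γ) p
      exact h a 0
    · exact h a n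
    · exact h _ _
  | zero => rw [map_zero, map_zero]
  | add x y _ _ hx hy => rw [map_add, map_add, hx, hy]
  | smul c x _ hx => rw [map_smul, map_smul, hx]

/-- Left multiplication by `x` prepends it to walks beginning at `x.next`. For `n = 0` the remaining
word is an idempotent, treated in `coord_walk_one_mul`. -/
theorem Word.coord_walk_succ_mul (x : Γ.Arrow) (n : ℕ) (hn : 0 < n) (h) (h') (z : Γ.Alg K) :
    (Word.walk x (n + 1) h).coord K (x.walkClass K 1 * z) =
      (Word.walk x.next n h').coord K z := by
  classical
  refine linearMap_ext_walkClass (f := (Word.walk x (n + 1) h).coord K ∘ₗ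
    LinearMap.mulLeft K (x.walkClass K 1)) (fun c m => ?_) z
  change (Word.walk x (n + 1) h).coord K (x.walkClass K 1 * c.walkClass K m) = _
  rw [coord_walk_walkClass]
  rcases m.eq_zero_or_pos with rfl | hm
  · rw [if_neg (by omega), Arrow.walkClass_zero]
    by_cases hc : x.next.start = c.start
    · rw [x.walkClass_mul_idemClass K (n := 1) hc, coord_walk_walkClass, if_neg (by omega)]
    · rw [x.walkClass_mul_idemClass_of_ne K (n := 1) hc, map_zero]
  · by_cases hc : c = x.next
    · subst hc
      rw [show x.walkClass K 1 * x.next.walkClass K m = _ from x.walkClass_mul_shift K 1 m,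
        coord_walk_walkClass]
      refine if_congr ?_ rfl rfl
      simp only [true_and]
      omega
    · rw [Arrow.walkClass_mul_walkClass K one_pos hm hc, map_zero,
        if_neg (fun h => hc h.1.symm)]

open Classical in
theorem Word.coord_walk_succ_mul_right (x y : Γ.Arrow) (n : ℕ) (hn : 0 < n) (h) (h')
    (z : Γ.Alg K) : (Word.walk x (n + 1) h).coord K (z * y.walkClass K 1) =
      if y = x.shift n then (Word.walk x n h').coord K z else 0 := by
  have key := linearMap_ext_walkClass (f := (Word.walk x (n + 1) h).coord K ∘ₗ
    LinearMap.mulRight K (y.walkClass K 1))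
    (g := if y = x.shift n then (Word.walk x n h').coord K else 0) (fun c m => ?_) z
  · refine key.trans ?_
    split_ifs <;> rfl
  change (Word.walk x (n + 1) h).coord K (c.walkClass K m * y.walkClass K 1) = _
  rw [show (if y = x.shift n then (Word.walk x n h').coord K else 0) (c.walkClass K m) =
    if y = x.shift n ∧ x = c ∧ n = m then 1 else 0 by
      by_cases hy : y = x.shift n
      · rw [if_pos hy, coord_walk_walkClass]
        exact if_congr (and_iff_right hy).symm rfl rfl
      · rw [if_neg hy, if_neg (fun h => hy h.1), LinearMap.zero_apply]]
  rcases m.eq_zero_or_pos with rfl | hm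
  · rw [if_neg (by omega), Arrow.walkClass_zero]
    by_cases hc : c.start = y.start
    · rw [hc, Arrow.idemClass_mul_walkClass, coord_walk_walkClass, if_neg (by omega)]
    · rw [Arrow.idemClass_mul_walkClass_of_ne K hc, map_zero]
  · by_cases hc : y = c.shift m
    · rw [hc, Arrow.walkClass_mul_shift, coord_walk_walkClass]
      refine if_congr ?_ rfl rfl
      constructor
      · rintro ⟨rfl, h2⟩
        obtain rfl : n = m := by omega
        exact ⟨rfl, rfl, rfl⟩
      · rintro ⟨-, rfl, rfl⟩
        exact ⟨rfl, rfl⟩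
    · rw [Arrow.walkClass_mul_walkClass K hm one_pos hc, map_zero, if_neg]
      rintro ⟨h1, rfl, rfl⟩
      exact hc h1

theorem Word.coord_walk_one_mul (x : Γ.Arrow) (h) (z : Γ.Alg K) :
    (Word.walk x 1 h).coord K (x.walkClass K 1 * z) =
      (Word.idem x.next.src : Γ.Word).coord K z := by
  classical
  refine linearMap_ext_walkClass (f := (Word.walk x 1 h).coord K ∘ₗ
    LinearMap.mulLeft K (x.walkClass K 1)) (fun c m => ?_) z
  change (Word.walk x 1 h).coord K (x.walkClass K 1 * c.walkClass K m) = _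
  rcases m.eq_zero_or_pos with rfl | hm
  · rw [Arrow.walkClass_zero, coord_idem_idemClass]
    by_cases hc : x.next.start = c.start
    · rw [x.walkClass_mul_idemClass K (n := 1) hc, coord_walk_walkClass, if_pos ⟨rfl, rfl⟩]
      exact (if_pos (Eq.symm hc)).symm
    · rw [x.walkClass_mul_idemClass_of_ne K (n := 1) hc, map_zero]
      exact (if_neg fun h' => hc (Eq.symm h')).symm
  · rw [coord_idem_walkClass K _ _ hm]
    by_cases hc : c = x.next
    · subst hc
      rw [show x.walkClass K 1 * x.next.walkClass K m = _ from x.walkClass_mul_shift K 1 m,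
        coord_walk_walkClass, if_neg (by omega)]
    · rw [Arrow.walkClass_mul_walkClass K one_pos hm hc, map_zero]

theorem Word.coord_walk_one_mul_right (x : Γ.Arrow) (h) (z : Γ.Alg K) :
    (Word.walk x 1 h).coord K (z * x.walkClass K 1) =
      (Word.idem x.src : Γ.Word).coord K z := by
  classical
  refine linearMap_ext_walkClass (f := (Word.walk x 1 h).coord K ∘ₗ
    LinearMap.mulRight K (x.walkClass K 1)) (fun c m => ?_) z
  change (Word.walk x 1 h).coord K (c.walkClass K m * x.walkClass K 1) = _
  rcases m.eq_zero_or_pos with rfl | hm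
  · rw [Arrow.walkClass_zero, coord_idem_idemClass]
    by_cases hc : c.start = x.start
    · rw [hc, Arrow.idemClass_mul_walkClass, coord_walk_walkClass, if_pos ⟨rfl, rfl⟩]
      exact (if_pos rfl).symm
    · rw [Arrow.idemClass_mul_walkClass_of_ne K hc, map_zero]
      exact (if_neg hc).symm
  · rw [coord_idem_walkClass K _ _ hm]
    by_cases hc : x = c.shift m
    · rw [show c.walkClass K m * x.walkClass K 1 = c.walkClass K (m + 1) by
        rw [hc, Arrow.walkClass_mul_shift], coord_walk_walkClass, if_neg (by omega)]
    · rw [Arrow.walkClass_mul_walkClass K hm one_pos hc, map_zero]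

theorem Word.coord_walk_idemClass_mul (x : Γ.Arrow) (n : ℕ) (h) (z : Γ.Alg K) :
    (Word.walk x n h).coord K (idemClass K x.start * z) = (Word.walk x n h).coord K z := by
  classical
  refine linearMap_ext_walkClass (f := (Word.walk x n h).coord K ∘ₗ
    LinearMap.mulLeft K (idemClass K x.start)) (fun c m => ?_) z
  change (Word.walk x n h).coord K (idemClass K x.start * c.walkClass K m) = _
  by_cases hc : x.start = c.start
  · rw [hc, Arrow.idemClass_mul_walkClass]
  · rw [Arrow.idemClass_mul_walkClass_of_ne K hc, map_zero, coord_walk_walkClass, if_neg]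
    rintro ⟨rfl, -⟩
    exact hc rfl

theorem Word.coord_walk_mul_idemClass (x : Γ.Arrow) (n : ℕ) (h) (z : Γ.Alg K)
    {v : Γ.QuiverVertex} (hv : (x.shift n).start ≠ v) :
    (Word.walk x n h).coord K (z * idemClass K v) = 0 := by
  classical
  refine linearMap_ext_walkClass (f := (Word.walk x n h).coord K ∘ₗ
    LinearMap.mulRight K (idemClass K v)) (g := 0) (fun c m => ?_) z
  change (Word.walk x n h).coord K (c.walkClass K m * idemClass K v) = 0
  by_cases hc : (c.shift m).start = v
  · rw [c.walkClass_mul_idemClass K hc, coord_walk_walkClass, if_neg]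
    rintro ⟨rfl, rfl⟩
    exact hv hc
  · rw [c.walkClass_mul_idemClass_of_ne K hc, map_zero]

end Center

section Center

variable {K : Type*} [Field K]

theorem Arrow.one_lt_socleLength (a : Γ.Arrow) : 0 < 1 ∧ 1 < a.socleLength :=
  ⟨one_pos, a.two_le_socleLength⟩

/-- Compares the coefficient of `a` itself in az and za; the arrow is a word of its own because L ≥
2. -/
theorem Word.coord_idem_next {z : Γ.Alg K} (hz : ∀ y, y * z = z * y) (a : Γ.Arrow) :
    (Word.idem a.next.src : Γ.Word).coord K z = (Word.idem a.src : Γ.Word).coord K z := by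
  rw [← coord_walk_one_mul K a a.one_lt_socleLength, hz, coord_walk_one_mul_right]

theorem Word.coord_idem_eq {z : Γ.Alg K} (hz : ∀ y, y * z = z * y) (hΓ : Γ.Connected) (p q : P) :
    (Word.idem p : Γ.Word).coord K z = (Word.idem q : Γ.Word).coord K z := by
  by_contra hpq
  obtain ⟨r, hr, s, hs, α, hαr, hαs⟩ := hΓ.2
    {r | (Word.idem r : Γ.Word).coord K z = (Word.idem q : Γ.Word).coord K z} ⟨q, rfl⟩ ⟨p, hpq⟩
  have hmem : ∀ t, α ∈ Γ.polygon t → 0 < Γ.occ α t := fun t ht => Multiset.count_pos.2 ht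
  have hrs : r ≠ s := by
    rintro rfl
    exact hs hr
  -- A truncated vertex has valency one and cannot lie in two different polygons.
  have hα : ¬ Γ.Truncated α := by
    intro h
    have h1 : Γ.val α = 1 := Nat.eq_one_of_mul_eq_one_right h
    have h2 := Finset.add_le_sum (s := Finset.univ) (f := fun t => Γ.occ α t)
      (fun _ _ => Nat.zero_le _) (Finset.mem_univ r) (Finset.mem_univ s) hrs
    have h3 := hmem r hαr
    have h4 := hmem s hαs
    change Γ.occ α r + Γ.occ α s ≤ Γ.val α at h2
    omega
  have hpos : ∀ t, α ∈ Γ.polygon t → ∃ a : Γ.Arrow, a.1 = ⟨α, hα⟩ ∧ a.src = t := by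
    intro t ht
    have h1 : t ∈ Γ.seq α := by
      rw [← List.count_pos_iff, Γ.count_seq]
      exact hmem t ht
    obtain ⟨i, hi⟩ := List.mem_iff_get.1 h1
    exact ⟨⟨⟨α, hα⟩, i⟩, rfl, hi⟩
  obtain ⟨a, ha, rfl⟩ := hpos r hαr
  obtain ⟨b, hb, rfl⟩ := hpos s hαs
  obtain ⟨n, rfl⟩ := Arrow.exists_shift_eq (ha.trans hb.symm)
  -- Going around α from one polygon to the other preserves the idempotent coordinate.
  refine hs (Eq.trans ?_ hr)
  clear hs hrs hαs hb
  induction n with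
  | zero => rfl
  | succ n ih => exact (coord_idem_next hz _).trans ih

theorem Word.coord_walk_congr {a b : Γ.Arrow} {m n : ℕ} (hab : a = b) (hmn : m = n) (h) (h')
    (z : Γ.Alg K) : (Word.walk a m h).coord K z = (Word.walk b n h').coord K z := by
  subst hab hmn
  rfl

open Classical in
-- Read off the coefficient of `a.walk (n + 1)` in az = za. On the left, `a` is stripped from the
-- front; on the right it can be stripped from the end only if the last arrow `a.shift n` is `a`.
-- The bound keeps the compared walk outside the socle.
theorem Word.coord_walk_next {z : Γ.Alg K} (hz : ∀ y, y * z = z * y) (a : Γ.Arrow) {n : ℕ}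
    (hn : 0 < n) (hn' : n + 1 < a.socleLength) (h) (h') :
    (Word.walk a.next n h).coord K z =
      if Γ.val a.vertex ∣ n then (Word.walk a n h').coord K z else 0 := by
  rw [← coord_walk_succ_mul K a n hn ⟨Nat.succ_pos _, hn'⟩, hz,
    coord_walk_succ_mul_right K a a n hn _ h']
  exact if_congr (eq_comm.trans (a.shift_eq_self_iff n)) rfl rfl

theorem Word.coord_walk_shift {z : Γ.Alg K} (hz : ∀ y, y * z = z * y) (a : Γ.Arrow) {n : ℕ}
    (hn : 0 < n) (hn' : n + 1 < a.socleLength) (hd : Γ.val a.vertex ∣ n) (k : ℕ) (h) (h') :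
    (Word.walk (a.shift k) n h).coord K z = (Word.walk a n h').coord K z := by
  induction k with
  | zero => rfl
  | succ k ih =>
    have hs := a.socleLength_shift k
    refine (coord_walk_next hz (a.shift k) hn (by omega) h ⟨hn, by omega⟩).trans ?_
    rw [if_pos (by rwa [a.vertex_shift]), ih]

theorem Word.coord_walk_eq_zero_of_not_dvd {z : Γ.Alg K} (hz : ∀ y, y * z = z * y) (a : Γ.Arrow)
    {n : ℕ} (hn : 0 < n) (hn' : n + 1 < a.socleLength) (hd : ¬ Γ.val a.vertex ∣ n) (h) :
    (Word.walk a n h).coord K z = 0 := by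
  obtain ⟨a, rfl⟩ : ∃ b : Γ.Arrow, b.next = a := ⟨a.prev, a.next_prev⟩
  exact (coord_walk_next hz a hn hn' h h).trans (if_neg hd)

/-- Uses commutation with the idempotent at the start only, so it also covers length L - 1. -/
theorem Word.coord_walk_eq_zero_of_not_closed {z : Γ.Alg K} (hz : ∀ y, y * z = z * y)
    (a : Γ.Arrow) (n : ℕ) (h) (ha : (a.shift n).src ≠ a.src) :
    (Word.walk a n h).coord K z = 0 := by
  rw [← coord_walk_idemClass_mul, hz]
  exact coord_walk_mul_idemClass K a n h z ha

theorem Arrow.not_val_dvd_socleLength_sub_one {a : Γ.Arrow} (h : 1 < Γ.val a.vertex) :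
    ¬ Γ.val a.vertex ∣ a.socleLength - 1 := by
  intro hd
  have h1 : Γ.val a.vertex ∣ a.socleLength := Dvd.intro _ rfl
  have h2 := Nat.dvd_sub h1 hd
  rw [Nat.sub_sub_self (by have := a.two_le_socleLength; omega), Nat.dvd_one] at h2
  omega

theorem Word.coord_walk_eq_of_fst_eq {z : Γ.Alg K} (hz : ∀ y, y * z = z * y) {a b : Γ.Arrow}
    (hab : a.1 = b.1) {n : ℕ} (hd : Γ.val a.vertex ∣ n) (h) (h') :
    (Word.walk a n h).coord K z = (Word.walk b n h').coord K z := by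
  by_cases hn : n + 1 < a.socleLength
  · obtain ⟨k, rfl⟩ := Arrow.exists_shift_eq hab
    exact (coord_walk_shift hz a h.1 hn hd k h' h).symm
  -- Here n = L - 1 is divisible by the valency, which forces valency one, and then the vertex has a
  -- single arrow.
  · refine coord_walk_congr (Arrow.ext_pos hab ?_) rfl _ _ z
    have h1 : n = a.socleLength - 1 := by omega
    have h2 := a.pos_lt
    have h3 : ¬ 1 < Γ.val a.vertex := fun h' =>
      Arrow.not_val_dvd_socleLength_sub_one h' (h1 ▸ hd)
    have h4 : (b.2 : ℕ) < Γ.val a.vertex := b.pos_lt.trans_eq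
      (congrArg (fun γ : {α : V // ¬ Γ.Truncated α} => Γ.val γ) hab.symm)
    omega

/-! ### The basis of the center -/

theorem length_seq_pos (α : V) : 0 < (Γ.seq α).length := length_seq (Γ := Γ) α ▸ val_pos α

theorem walk_bounds_of_power {α : {α : V // ¬ Γ.Truncated α}} {j : ℕ}
    (hj : 1 ≤ j ∧ j ≤ Γ.mult α - 1) (i : Fin (Γ.seq α).length) :
    0 < Γ.val α * j ∧ Γ.val α * j < (arrowAt α i).socleLength :=
  ⟨Nat.mul_pos (val_pos _) hj.1, Nat.mul_lt_mul_of_pos_left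
    (show j < Γ.mult α by omega) (val_pos α.1)⟩

theorem Arrow.walk_bounds_of_mixed (a : Γ.Arrow) :
    0 < a.socleLength - 1 ∧ a.socleLength - 1 < a.next.socleLength := by
  have h := a.two_le_socleLength
  change _ ∧ _ < a.socleLength
  omega

theorem arrowAt_injective (α : {α : V // ¬ Γ.Truncated α}) :
    Function.Injective (arrowAt (Γ := Γ) α) :=
  fun _ _ h => eq_of_heq (Sigma.mk.inj h).2

/-- The basis element of the standard basis of the algebra that distinguishes an element of the
basis of the center from the others. -/
def CenterIndex.word (p₀ : P) : Γ.CenterIndex → Γ.Word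
  | .one => .idem p₀
  | .power α j hj => .walk (arrowAt α ⟨0, length_seq_pos _⟩) (Γ.val α * j)
      (walk_bounds_of_power hj _)
  | .socle p => .socle p
  | .mixed a _ _ => .walk a.next (a.socleLength - 1) a.walk_bounds_of_mixed

theorem CenterIndex.word_power (p₀ : P) (α : {α : V // ¬ Γ.Truncated α}) (j : ℕ) (hj) :
    (CenterIndex.power α j hj).word p₀ = .walk (arrowAt α ⟨0, length_seq_pos _⟩) (Γ.val α * j)
      (walk_bounds_of_power hj _) := rfl

variable (K) in
/-- The elements of the basis of the center. -/
noncomputable def CenterIndex.toAlg : Γ.CenterIndex → Γ.Alg K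
  | .one => 1
  | .power α j _ => Γ.sumCycles K α ^ j
  | .socle p => socleClass K p
  | .mixed a _ _ => a.next.walkClass K (a.socleLength - 1)

theorem CenterIndex.toAlg_mem_center (i : Γ.CenterIndex) :
    i.toAlg K ∈ Subalgebra.center K (Γ.Alg K) := by
  cases i with
  | one => exact one_mem _
  | power α j hj => exact pow_mem (sumCycles_mem_center K α) j
  | socle p => exact socleClass_mem_center K p
  | mixed a ha _ => exact a.mixed_mem_center K ha

theorem eq_zero_of_mem_center {z : Γ.Alg K} (hz : ∀ y, y * z = z * y) (hΓ : Γ.Connected) (p₀ : P)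
    (h : ∀ i : Γ.CenterIndex, (i.word p₀).coord K z = 0) : z = 0 := by
  refine eq_zero_of_coord_eq_zero K fun b => ?_
  rcases b with p | ⟨a, n, hn⟩ | p
  · exact (Word.coord_idem_eq hz hΓ p p₀).trans (h .one)
  · by_cases hd : Γ.val a.vertex ∣ n
    · obtain ⟨j, rfl⟩ := id hd
      have hj : 1 ≤ j ∧ j ≤ Γ.mult a.1 - 1 := by
        have h1 := Nat.pos_of_mul_pos_left hn.1
        have h2 : j < Γ.mult a.1 := Nat.lt_of_mul_lt_mul_left hn.2
        omega
      have h1 := h (.power a.1 j hj)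
      rw [CenterIndex.word_power] at h1
      have h2 : a.1 = (arrowAt a.1 ⟨0, length_seq_pos _⟩).1 := rfl
      exact (Word.coord_walk_eq_of_fst_eq hz h2 hd hn (walk_bounds_of_power hj _)).trans h1
    · by_cases hn' : n + 1 < a.socleLength
      · exact Word.coord_walk_eq_zero_of_not_dvd hz a hn.1 hn' hd hn
      · obtain rfl : n = a.socleLength - 1 := by omega
        by_cases hc : (a.shift (a.socleLength - 1)).src = a.src
        -- The new `a` is the arrow missing from the cycle; closedness of the walk says that it is a
        -- loop.
        · obtain ⟨a, rfl⟩ : ∃ b : Γ.Arrow, b.next = a := ⟨a.prev, a.next_prev⟩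
          have hv : 1 < Γ.val a.vertex := by
            have h1 := val_pos (Γ := Γ) a.vertex
            rcases Nat.lt_or_eq_of_le h1 with h2 | h2
            · exact h2
            · refine absurd ?_ hd
              change Γ.val a.vertex ∣ _
              rw [← h2]
              exact one_dvd _
          have hs : a.next.shift (a.next.socleLength - 1) = a := a.shift_next_socleLength_sub_one
          rw [hs] at hc
          exact h (.mixed a hc hv)
        · exact Word.coord_walk_eq_zero_of_not_closed hz a _ hn hc
  · exact h (.socle p)

theorem one_eq_sum_idemClass : (1 : Γ.Alg K) = ∑ v : Γ.QuiverVertex, idemClass K v := by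
  refine (map_one (Γ.proj K)).symm.trans ?_
  rw [PathAlgebra.one_def, map_sum]
  rfl

open Classical in
-- The delicate case is a power against a mixed cycle: the valency divides the length of the first
-- but not L - 1, since it exceeds one.
theorem CenterIndex.coord_word_toAlg (p₀ : P) (i j : Γ.CenterIndex) :
    (i.word p₀).coord K (j.toAlg K) = if i = j then 1 else 0 := by
  rcases j with _ | ⟨β, k, hk⟩ | p | ⟨c, hc, hcv⟩
  · change Word.coord K _ 1 = _
    rw [one_eq_sum_idemClass, map_sum]
    rcases i with _ | ⟨α, j, hj⟩ | q | ⟨a, ha, hav⟩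
    · rw [if_pos rfl]
      refine (Finset.sum_congr rfl fun v _ => Word.coord_idem_idemClass K p₀ v).trans ?_
      refine (Fintype.sum_eq_single (M := K) (show Γ.QuiverVertex from p₀)
        fun v hv => if_neg hv).trans (if_pos rfl)
    · rw [if_neg (by simp)]
      exact Finset.sum_eq_zero fun v _ => Word.coord_walk_idemClass K _ _ _ v
    · rw [if_neg (by simp)]
      exact Finset.sum_eq_zero fun v _ => Word.coord_socle_idemClass K _ v
    · rw [if_neg (by simp)]
      exact Finset.sum_eq_zero fun v _ => Word.coord_walk_idemClass K _ _ _ v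
  · change Word.coord K _ (Γ.sumCycles K β ^ k) = _
    rw [sumCycles_pow K β hk.1, map_sum]
    rcases i with _ | ⟨α, j, hj⟩ | q | ⟨a, ha, hav⟩
    · rw [if_neg (by simp)]
      exact Finset.sum_eq_zero fun i _ =>
        Word.coord_idem_walkClass K _ _ (walk_bounds_of_power hk i).1
    · refine (Finset.sum_congr rfl fun i _ => Word.coord_walk_walkClass K _ _ _ _ _).trans ?_
      by_cases h : α = β
      · subst h
        -- Only the summand starting at position 0 is the word chosen to detect this power.
        rw [Finset.sum_eq_single ⟨0, length_seq_pos _⟩]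
        · refine if_congr ?_ rfl rfl
          simp [Nat.mul_left_cancel_iff (val_pos (Γ := Γ) α.1)]
        · intro i _ hi
          exact if_neg fun h => hi (arrowAt_injective α h.1).symm
        · simp
      · rw [if_neg (by simp [h])]
        exact Finset.sum_eq_zero fun i _ => if_neg fun h' => h (congrArg Sigma.fst h'.1)
    · rw [if_neg (by simp)]
      refine Finset.sum_eq_zero fun i _ => (Word.coord_socle_walkClass K _ _ _).trans (if_neg ?_)
      exact fun h => (walk_bounds_of_power hk i).2.ne h.2
    · rw [if_neg (by simp)]
      refine Finset.sum_eq_zero fun i _ => (Word.coord_walk_walkClass K _ _ _ _ _).trans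
        (if_neg ?_)
      rintro ⟨h1, h2⟩
      refine Arrow.not_val_dvd_socleLength_sub_one hav ?_
      have h3 : a.vertex = β := congrArg Subtype.val (congrArg Sigma.fst h1 : a.1 = β)
      rw [h2, h3]
      exact Dvd.intro _ rfl
  · obtain ⟨c, rfl⟩ := Arrow.exists_src_eq (Γ := Γ) p
    change Word.coord K _ (socleClass K c.src) = _
    rw [socleClass_src]
    have h2 := c.two_le_socleLength
    have key : ∀ (a : Γ.Arrow) (n : ℕ) (h),
        (Word.walk a n h).coord K (c.walkClass K c.socleLength) = 0 := by
      intro a n h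
      rw [Word.coord_walk_walkClass, if_neg]
      rintro ⟨rfl, h3⟩
      exact h.2.ne h3
    rcases i with _ | ⟨α, j, hj⟩ | q | ⟨a, ha, hav⟩
    · exact (Word.coord_idem_walkClass K _ _ (by omega)).trans (if_neg (by simp)).symm
    · exact (key _ _ _).trans (if_neg (by simp)).symm
    · refine (Word.coord_socle_walkClass K _ _ _).trans (if_congr ?_ rfl rfl)
      simp [eq_comm]
    · exact (key _ _ _).trans (if_neg (by simp)).symm
  · change Word.coord K _ (c.next.walkClass K (c.socleLength - 1)) = _
    have h2 := c.walk_bounds_of_mixed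
    rcases i with _ | ⟨α, j, hj⟩ | q | ⟨a, ha, hav⟩
    · exact (Word.coord_idem_walkClass K _ _ h2.1).trans (if_neg (by simp)).symm
    · refine (Word.coord_walk_walkClass K _ _ _ _ _).trans ?_
      rw [if_neg, if_neg (by simp)]
      rintro ⟨h3, h4⟩
      refine Arrow.not_val_dvd_socleLength_sub_one hcv ?_
      have h5 : α.1 = c.vertex := congrArg Subtype.val (congrArg Sigma.fst h3 : α = c.1)
      rw [← h4, h5]
      exact Dvd.intro _ rfl
    · refine (Word.coord_socle_walkClass K _ _ _).trans ?_
      rw [if_neg (fun h => h2.2.ne h.2), if_neg (by simp)]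
    · refine (Word.coord_walk_walkClass K _ _ _ _ _).trans (if_congr ?_ rfl rfl)
      rw [CenterIndex.mixed.injEq]
      constructor
      · exact fun h => Arrow.next_injective h.1
      · rintro rfl
        exact ⟨rfl, rfl⟩

end Center

/-- Duality gives independence; for spanning, z - ∑ f j z • v j is killed by all functionals. -/
theorem exists_basis_of_dual {K ι M : Type*} [Field K] [AddCommGroup M] [Module K M] [Finite ι]
    (v : ι → M) (f : ι → M →ₗ[K] K) (h : ∀ i, f i (v i) = 1) (h' : ∀ i j, i ≠ j → f i (v j) = 0)
    (hf : ∀ z, (∀ i, f i z = 0) → z = 0) : ∃ b : Module.Basis ι K M, ∀ i, b i = v i := by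
  classical
  have := Fintype.ofFinite ι
  have key : ∀ (c : ι → K) i, f i (∑ j, c j • v j) = c i := by
    intro c i
    rw [map_sum, Finset.sum_eq_single i]
    · rw [map_smul, h, smul_eq_mul, mul_one]
    · intro j _ hj
      rw [map_smul, h' i j hj.symm, smul_zero]
    · simp
  have hv : LinearIndependent K v := by
    rw [Fintype.linearIndependent_iff]
    intro c hc i
    rw [← key c i, hc, map_zero]
  have hs : ⊤ ≤ Submodule.span K (Set.range v) := by
    intro z _
    have hz : z = ∑ j, f j z • v j := by
      rw [← sub_eq_zero]
      refine hf _ fun i => ?_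
      rw [map_sub, key, sub_self]
    rw [hz]
    exact Submodule.sum_mem _ fun j _ => Submodule.smul_mem _ _ (Submodule.subset_span ⟨j, rfl⟩)
  exact ⟨.mk hv hs, fun i => Module.Basis.mk_apply hv hs i⟩

/-! ### The number of basis elements -/

variable (Γ) in
/-- The labels of the basis of the center as a sum type. -/
def centerIndexEquiv : Γ.CenterIndex ≃
    Unit ⊕ (Σ α : {α : V // ¬ Γ.Truncated α}, Fin (Γ.mult α - 1)) ⊕ P ⊕
      {a : Γ.Arrow // a.src = a.tgt ∧ 1 < Γ.val a.vertex} where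
  toFun
    | .one => .inl ()
    | .power α j hj => .inr (.inl ⟨α, ⟨j - 1, by omega⟩⟩)
    | .socle p => .inr (.inr (.inl p))
    | .mixed a ha hv => .inr (.inr (.inr ⟨a, ha, hv⟩))
  invFun
    | .inl _ => .one
    | .inr (.inl ⟨α, j⟩) => .power α (j + 1) ⟨by omega, by omega⟩
    | .inr (.inr (.inl p)) => .socle p
    | .inr (.inr (.inr a)) => .mixed a.1 a.2.1 a.2.2
  left_inv i := by
    rcases i with _ | ⟨α, j, hj⟩ | p | ⟨a, ha, hv⟩
    · rfl
    · have := hj.1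
      simp only [CenterIndex.power.injEq, true_and]
      omega
    · rfl
    · rfl
  right_inv i := by
    rcases i with _ | ⟨α, j⟩ | p | a <;> rfl

variable (Γ) in
/-- The loops of the quiver as arrows. -/
def loopEquiv : (Σ v : Γ.QuiverVertex, (v ⟶ v)) ≃ {a : Γ.Arrow // a.src = a.tgt} where
  toFun e := ⟨e.2.1, e.2.2.1.trans e.2.2.2.symm⟩
  invFun a := ⟨a.1.start, ⟨a.1, rfl, a.2.symm⟩⟩
  left_inv := by
    rintro ⟨v, a, rfl, h⟩
    rfl
  right_inv _ := rfl

theorem Arrow.src_eq_tgt_of_val_eq_one {a : Γ.Arrow} (h : Γ.val a.vertex = 1) : a.src = a.tgt := by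
  have : a.next = a := (a.shift_eq_self_iff 1).2 (by rw [h])
  rw [tgt, this]

variable (Γ) in
/-- The arrows of the vertices of valency one correspond to these vertices. -/
def valOneEquiv [Fintype V] : {a : Γ.Arrow // Γ.val a.vertex = 1} ≃ Γ.setC where
  toFun a := ⟨a.1.vertex, by
    have h := a.1.two_le_socleLength
    rw [Arrow.socleLength, a.2, one_mul] at h
    exact Finset.mem_filter.2 ⟨Finset.mem_univ _, a.2, h⟩⟩
  invFun α := ⟨⟨⟨α.1, by
    have h := (Finset.mem_filter.1 α.2).2
    rw [Truncated, h.1, one_mul]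
    omega⟩, ⟨0, length_seq_pos _⟩⟩, (Finset.mem_filter.1 α.2).2.1⟩
  left_inv a := by
    refine Subtype.ext (Arrow.ext_pos rfl ?_)
    have := a.1.pos_lt
    rw [a.2] at this
    change 0 = (a.1.2 : ℕ)
    omega
  right_inv _ := rfl

instance [Finite V] : Finite Γ.Arrow :=
  inferInstanceAs (Finite (Σ α : {α : V // ¬ Γ.Truncated α}, Fin (Γ.seq α).length))

instance [Finite V] : Finite Γ.CenterIndex := Finite.of_equiv _ Γ.centerIndexEquiv.symm

/-- Split the loops by valency: at valency one every arrow is a loop, and these arrows correspond to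
𝒞_Γ. -/
theorem numLoops_eq [Fintype V] :
    Γ.numLoops = Nat.card {a : Γ.Arrow // a.src = a.tgt ∧ 1 < Γ.val a.vertex} + Γ.setC.card := by
  classical
  rw [numLoops, Nat.card_congr Γ.loopEquiv, ← Fintype.card_coe, ← Nat.card_eq_fintype_card,
    ← Nat.card_congr Γ.valOneEquiv, ← Nat.card_sum]
  refine Nat.card_congr (((Equiv.sumCompl fun a : {a : Γ.Arrow // a.src = a.tgt} =>
    1 < Γ.val a.1.vertex).symm).trans (Equiv.sumCongr ?_ ?_))
  · exact Equiv.subtypeSubtypeEquivSubtypeInter _ (fun a : Γ.Arrow => 1 < Γ.val a.vertex)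
  · refine (Equiv.subtypeSubtypeEquivSubtypeInter _
      (fun a : Γ.Arrow => ¬ 1 < Γ.val a.vertex)).trans (Equiv.subtypeEquivRight fun a => ?_)
    have := val_pos (Γ := Γ) a.vertex
    constructor
    · rintro ⟨-, h⟩
      omega
    · exact fun h => ⟨Arrow.src_eq_tgt_of_val_eq_one h, by omega⟩

theorem card_centerIndex [Fintype V] : (Nat.card Γ.CenterIndex : ℤ) =
    1 + ∑ α : V, (Γ.mult α : ℤ) + Fintype.card P - Fintype.card V + Γ.numLoops - Γ.setC.card := by
  have h1 : ∑ α : {α : V // ¬ Γ.Truncated α}, ((Γ.mult α - 1 : ℕ) : ℤ) =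
      ∑ α : V, (Γ.mult α : ℤ) - Fintype.card V := by
    have h2 : ∑ α : V, (Γ.mult α : ℤ) - Fintype.card V = ∑ α : V, ((Γ.mult α - 1 : ℕ) : ℤ) := by
      rw [Fintype.card, Finset.card_eq_sum_ones, Nat.cast_sum, ← Finset.sum_sub_distrib]
      refine Finset.sum_congr rfl fun α _ => ?_
      rw [Nat.cast_sub (Γ.mult_pos α)]
    rw [h2, ← Finset.sum_filter_add_sum_filter_not Finset.univ (fun α => ¬ Γ.Truncated α),
      Finset.sum_subtype (p := fun α => ¬ Γ.Truncated α) _ (by simp), left_eq_add]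
    -- Truncated vertices have multiplicity one and contribute μ - 1 = 0, so the sum extends to all
    -- vertices.
    refine Finset.sum_eq_zero fun α hα => ?_
    have h3 : Γ.Truncated α := by simpa using hα
    rw [Nat.eq_one_of_mul_eq_one_left h3]
    rfl
  rw [Nat.card_congr Γ.centerIndexEquiv, Nat.card_sum, Nat.card_sum, Nat.card_sum, Nat.card_sigma,
    numLoops_eq]
  simp only [Nat.card_eq_fintype_card, Fintype.card_fin, Fintype.card_unit, Nat.cast_add,
    Nat.cast_sum, h1, Nat.cast_one]
  ring

end BrauerConfiguration

open BrauerConfiguration in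
theorem mainTheorem1 {K : Type*} [Field K] {V P : Type*} [Fintype V] [Fintype P]
    [DecidableEq V] [DecidableEq P] (Γ : BrauerConfiguration V P)
    (hconn : Γ.Connected) (hred : Γ.Reduced) :
    (∃ b : Module.Basis Γ.CenterIndex K (Subalgebra.center K (Γ.Alg K)),
      (b .one : Γ.Alg K) = 1 ∧
      (∀ α j hj, (b (.power α j hj) : Γ.Alg K) = Γ.sumCycles K α ^ j) ∧
      (∀ a : Γ.Arrow,
        (b (.socle a.src) : Γ.Alg K) = Γ.proj K (a.cycleElt K ^ Γ.mult a.vertex)) ∧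
      (∀ a ha hval, (b (.mixed a ha hval) : Γ.Alg K) = Γ.proj K (a.mixedCycle K))) ∧
    Module.Finite K (Subalgebra.center K (Γ.Alg K)) ∧
    (Module.finrank K (Subalgebra.center K (Γ.Alg K)) : ℤ) =
      1 + ∑ α : V, (Γ.mult α : ℤ) + Fintype.card P - Fintype.card V + Γ.numLoops
        - Γ.setC.card := by
  obtain ⟨p₀⟩ := hconn.1
  obtain ⟨b, hb⟩ := exists_basis_of_dual (K := K)
    (fun i : Γ.CenterIndex => (⟨i.toAlg K, i.toAlg_mem_center⟩ : Subalgebra.center K (Γ.Alg K)))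
    (fun i => (i.word p₀).coord K ∘ₗ (Subalgebra.center K (Γ.Alg K)).val.toLinearMap)
    (fun i => (CenterIndex.coord_word_toAlg p₀ i i).trans (if_pos rfl))
    (fun i j hij => (CenterIndex.coord_word_toAlg p₀ i j).trans (if_neg hij))
    (fun z hz => Subtype.ext (eq_zero_of_mem_center (Subalgebra.mem_center_iff.1 z.2) hconn p₀ hz))
  refine ⟨⟨b, ?_, fun α j hj => ?_, fun a => ?_, fun a ha hval => ?_⟩, .of_basis b, ?_⟩
  · rw [hb]
    rfl
  · rw [hb]
    rfl
  · rw [hb, a.cycleElt_pow_mult K]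
    exact socleClass_src K a
  · rw [hb, a.mixedCycle_eq K]
    rfl
  · rw [Module.finrank_eq_nat_card_basis b, card_centerIndex]
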